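/- **Setting.** Let $K\ge 2$, let $\Omega\subseteq\mathbb R$, and let $\mathbb F=(\mathbb F_1,\dots,\mathbb F_K)$ be probability measures on $\Omega$ (the arms) that are $1$-sub-Gaussian in the sense that $\mathbb F_i(\{x:|x|>t\})\le 2e^{-t^2/2}$ for all $t\ge 0$. Let $h:[0,1]\to[0,1]$ satisfy $h(0)=0$. For a probability measure $\mathbb Q$ on $\mathbb R$ with CDF $\mathbb Q(x)$ the preference metric (PM) is $$U_h(\mathbb Q)=\int_{-\infty}^0\big(h(1-\mathbb Q(x))-h(1)\big)\,dx+\int_0^\infty h(1-\mathbb Q(x))\,dx .$$ Let $\|\mathbb G_1-\mathbb G_2\|_{\rm W}$ denote the 1-Wasserstein distance. Assume that, for some $q\in(0,1]$ and $L\ge 0$, the PM is finite and Hölder continuous with exponent $q$ and constant $L$: for all probability measures $\mathbb G_1,\mathbb G_2$ on $\Omega$ with finite first moment, $U_h(\mathbb G_1),U_h(\mathbb G_2)$ are finite and $U_h(\mathbb G_1)-U_h(\mathbb G_2)\le L\,\|\mathbb G_1-\mathbb G_2\|_{\rm W}^q$. Write $\Delta^{K-1}$ for the probability simplex in $\mathbb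 R^K$, $V(a,\mathbb F)=U_h(\sum_i a(i)\mathbb F_i)$, and $$W=\sup_{\alpha\ne\beta\in\Delta^{K-1}}\frac{\|\sum_i\alpha_i\mathbb F_i-\sum_i\beta_i\mathbb F_i\|_{\rm W}}{\|\alpha-\beta\|_1}.$$ For $\varepsilon>0$ let $\Delta^{K-1}_\varepsilon$ be the set of $a\in\Delta^{K-1}$ whose first $K-1$ coordinates are nonnegative integer multiples of $\varepsilon$ (for $1/\varepsilon\in\mathbb N$ this is $\{\varepsilon n: n\in\mathbb N^K,\ \sum_i\varepsilon n_i=1\}$, where $0\in\mathbb N$). Let $\alpha^\star$ maximize $V(\cdot,\mathbb F)$ over $\Delta^{K-1}$, let $a^{(1)}$ maximize it over $\Delta^{K-1}_\varepsilon$ and $a^{(2)}$ over $\Delta^{K-1}_\varepsilon\setminus\{a^{(1)}\}$; put $\delta_{01}(\varepsilon)=V(\alpha^\star,\mathbb F)-V(a^{(1)},\mathbb F)$ and $\delta_{12}(\varepsilon)=V(a^{(1)},\mathbb F)-V(a^{(2)},\mathbb F)$, and assume $\delta_{12}(\varepsilon)>0$. For a horizon $T\in\mathbb N$ let $$N(\varepsilon)=256Ke\Big(\frac{2KL}{\delta_{12}(\varepsilon)}\Big)^{2/q}\Big[\frac{32}{\sqrt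 e}+\sqrt{\log\big(2KT^2(\varepsilon^{-(K-1)}+1)\big)}\,\Big]^2,\qquad M(\varepsilon)=\frac{N(\varepsilon)}{\log T}.$$ **The algorithm PM-ETC-M.** Explore: pull every arm $m=\lceil N(\varepsilon)/K\rceil$ times, in some fixed order. Then choose $\hat a\in\arg\max_{a\in\Delta^{K-1}_\varepsilon}U_h(\sum_i a(i)\hat{\mathbb F}_i)$, where $\hat{\mathbb F}_i$ is the empirical distribution of the $m$ rewards of arm $i$ (ties broken arbitrarily). Commit: for $i=1,\dots,K-1$ in this order, pull arm $i$ until it has been pulled at least $\lfloor T\hat a(i)\rfloor$ times in total (skip it if it already has), then pull arm $K$ in all remaining rounds; stop after $T$ rounds in any case. Given the past actions and rewards and the current action $A_t$, the reward has law $\mathbb F_{A_t}$. Let $\tau_T(i)$ be the number of pulls of arm $i$ in $T$ rounds, and let the regret be $\mathfrak R^{\rm E}(T)=V(\alpha^\star,\mathbb F)-\mathbb E\big[V(\tfrac1T\tau_T,\mathbb F)\big]$. **Theorem 5 (PM-ETC-M, $\varepsilon$-dependent).** For every $T>N(\varepsilon)$, the regret of PM-ETC-M satisfies $$\mathfrak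 R^{\rm E}(T)\le (LK+W^{-q})\Big(3W\,M(\varepsilon)\,\frac{\log T}{T}\Big)^q+\delta_{01}(\varepsilon),$$ and $M(\varepsilon)=O(1)$ as $T\to\infty$, with the instance and $\varepsilon$ fixed. -/

import Mathlib

open MeasureTheory ProbabilityTheory Set Filter

noncomputable section

namespace PMBandit

/-! ### Preference metrics, mixtures, Wasserstein distance -/

/-- The two integrands of the signed Choquet integral are Lebesgue integrable, i.e. the preference
metric of `Q` is a well-defined real number. -/
def PMFinite (h : ℝ → ℝ) (Q : Measure ℝ) : Prop :=
  IntegrableOn (fun x => h (1 - cdf Q x) - h 1) (Iio 0) ∧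
    IntegrableOn (fun x => h (1 - cdf Q x)) (Ioi 0)

/-- The preference metric `U_h(Q)`: the signed Choquet integral with distortion function `h` of
the probability measure `Q` on the real line. -/
def U (h : ℝ → ℝ) (Q : Measure ℝ) : ℝ :=
  (∫ x in Iio (0 : ℝ), (h (1 - cdf Q x) - h 1)) + ∫ x in Ioi (0 : ℝ), h (1 - cdf Q x)

/-- The mixture `∑ i, a i • F i`. -/
def mix {K : ℕ} (a : Fin K → ℝ) (F : Fin K → Measure ℝ) : Measure ℝ :=
  ∑ i, ENNReal.ofReal (a i) • F i

/-- `V(a, F)`: the preference metric of the mixture of the arms `F` with coefficients `a`. -/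
def V {K : ℕ} (h : ℝ → ℝ) (a : Fin K → ℝ) (F : Fin K → Measure ℝ) : ℝ :=
  U h (mix a F)

/-- The 1-Wasserstein distance: infimum of the transport cost over all couplings. -/
def W1 (μ ν : Measure ℝ) : ℝ :=
  (⨅ γ : {γ : Measure (ℝ × ℝ) // γ.map Prod.fst = μ ∧ γ.map Prod.snd = ν},
    ∫⁻ z, edist z.1 z.2 ∂γ.1).toReal

/-- The largest ratio between the Wasserstein distance of two mixtures of arms and the
`ℓ¹`-distance of their mixing coefficients. -/
def W {K : ℕ} (F : Fin K → Measure ℝ) : ℝ :=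
  sSup {r : ℝ | ∃ α ∈ stdSimplex ℝ (Fin K), ∃ β ∈ stdSimplex ℝ (Fin K), α ≠ β ∧
    r = W1 (mix α F) (mix β F) / ∑ i, |α i - β i|}

/-- `1`-sub-Gaussian tails (about the origin): `P(|X| > t) ≤ 2 exp(-t² / 2)` for all `t ≥ 0`. -/
def IsOneSubGaussian (G : Measure ℝ) : Prop :=
  ∀ t : ℝ, 0 ≤ t → G.real {x | t < |x|} ≤ 2 * Real.exp (-t ^ 2 / 2)

/-- The probability measures supported on `Ω ⊆ ℝ` with finite first moment. -/
def P1 (Ω : Set ℝ) : Set (Measure ℝ) :=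
  {G | IsProbabilityMeasure G ∧ G Ωᶜ = 0 ∧ Integrable (fun x : ℝ => x) G}

/-- The preference metric is (finite and) Hölder continuous with exponent `q` and constant `L`
with respect to the 1-Wasserstein distance, on the probability measures on `Ω` with finite first
moment. -/
def IsHolderPM (Ω : Set ℝ) (h : ℝ → ℝ) (q L : ℝ) : Prop :=
  (∀ G ∈ P1 Ω, PMFinite h G) ∧
    ∀ G₁ ∈ P1 Ω, ∀ G₂ ∈ P1 Ω, U h G₁ - U h G₂ ≤ L * W1 G₁ G₂ ^ q

/-! ### Discretized simplex, exploration length -/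

/-- The simplex discretized at level `ε`: the first `K - 1` coordinates are natural multiples of
`ε`, the last one takes up the remainder. -/
def discSimplex (K : ℕ) (ε : ℝ) : Set (Fin K → ℝ) :=
  {a | a ∈ stdSimplex ℝ (Fin K) ∧ ∀ i : Fin K, (i : ℕ) + 1 < K → ∃ n : ℕ, a i = ε * n}

/-- When `1 / ε` is an integer, the discretized simplex is `{ε n : n ∈ ℕ^K, ∑ i, ε n i = 1}`. -/
theorem discSimplex_eq (K m : ℕ) (hm : 0 < m) :
    discSimplex K (1 / (m : ℝ)) =
      {a | ∃ n : Fin K → ℕ, (a = fun i => 1 / (m : ℝ) * n i) ∧ ∑ i, 1 / (m : ℝ) * n i = 1} := by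
  have hm' : (0 : ℝ) < m := by exact_mod_cast hm
  rcases K with _ | k
  · ext a
    simp [discSimplex, stdSimplex]
  ext a
  constructor
  · rintro ⟨⟨ha0, ha1⟩, hn⟩
    have hn' : ∀ j : Fin k, ∃ n : ℕ, a j.castSucc = 1 / (m : ℝ) * n := fun j =>
      hn _ (by simp)
    choose n hn using hn'
    have hlast : a (Fin.last k) = 1 - 1 / (m : ℝ) * ∑ j, (n j : ℝ) := by
      rw [Fin.sum_univ_castSucc] at ha1
      simp only [hn] at ha1
      rw [Finset.mul_sum]
      linarith
    have hle : ∑ j, n j ≤ m := by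
      have h1 := ha0 (Fin.last k)
      rw [hlast] at h1
      have h2 : 1 / (m : ℝ) * ∑ j, (n j : ℝ) ≤ 1 := by linarith
      rw [one_div, inv_mul_le_iff₀ hm', mul_one] at h2
      exact_mod_cast h2
    have ha : a = fun i => 1 / (m : ℝ) * ((Fin.snoc n (m - ∑ j, n j) : Fin (k + 1) → ℕ) i) := by
      funext i
      refine Fin.lastCases ?_ (fun j => ?_) i
      · rw [hlast, Fin.snoc_last, Nat.cast_sub hle]
        push_cast
        field_simp
      · rw [hn, Fin.snoc_castSucc]
    exact ⟨_, ha, (Finset.sum_congr rfl fun i _ => (congrFun ha i).symm).trans ha1⟩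
  · rintro ⟨n, rfl, hsum⟩
    exact ⟨⟨fun i => by positivity, hsum⟩, fun i _ => ⟨n i, rfl⟩⟩

/-- The argmax set of a real function over a set. -/
def argmaxOn {α : Type*} (f : α → ℝ) (s : Set α) : Set α :=
  {a | a ∈ s ∧ ∀ b ∈ s, f b ≤ f a}

/-- The exploration length `N(ε)`, as a function of the number of arms `K`, the Hölder
parameters `L`, `q`, the gap `δ = δ₁₂(ε)`, the level `ε` and the horizon `T`. -/
def explorationLength (K : ℕ) (L q δ ε : ℝ) (T : ℕ) : ℝ :=
  256 * K * Real.exp 1 * (2 * K * L / δ) ^ (2 / q) *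
    (32 / √(Real.exp 1) + √(Real.log (2 * K * (T : ℝ) ^ 2 * ((ε ^ (K - 1))⁻¹ + 1)))) ^ 2

/-- `M(ε) = N(ε) / log T`. -/
def explorationFactor (K : ℕ) (L q δ ε : ℝ) (T : ℕ) : ℝ :=
  explorationLength K L q δ ε T / Real.log T

/-- The number of pulls of each arm in the exploration phase: `⌈N(ε) / K⌉`. -/
def pullsPerArm (K : ℕ) (L q δ ε : ℝ) (T : ℕ) : ℕ :=
  ⌈explorationLength K L q δ ε T / K⌉₊

/-! ### Bandit interaction -/

section Interaction

variable {S : Type*} {K : ℕ}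

/-- The number of pulls of arm `i` in the first `t` rounds (the rounds are `0, …, t - 1`). -/
def pulls (A : ℕ → S → Fin K) (t : ℕ) (ω : S) (i : Fin K) : ℕ :=
  ((Finset.range t).filter fun s => A s ω = i).card

/-- The empirical distribution of the rewards of arm `i` in the first `t` rounds. -/
def empirical (A : ℕ → S → Fin K) (X : ℕ → S → ℝ) (t : ℕ) (ω : S) (i : Fin K) : Measure ℝ :=
  (pulls A t ω i : ENNReal)⁻¹ •
    ∑ s ∈ (Finset.range t).filter (fun s => A s ω = i), Measure.dirac (X s ω)

/-- The Markov kernel that, given a history and an arm, returns the distribution of this arm. -/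
def armKernel (F : Fin K → Measure ℝ) (t : ℕ) :
    Kernel ((Fin t → Fin K × ℝ) × Fin K) ℝ :=
  (Kernel.ofFunOfCountable F).comap Prod.snd measurable_snd

/-- The actions `A` and the rewards `X` are an interaction of a policy with the bandit `F` over
`T` rounds: in each round, given the past actions and rewards and the current action, the
reward is distributed according to the arm that is pulled. -/
def IsInteraction [MeasurableSpace S] (P : Measure S) (F : Fin K → Measure ℝ) (T : ℕ)
    (A : ℕ → S → Fin K) (X : ℕ → S → ℝ) : Prop :=
  ∀ t < T, HasCondDistrib (X t)
    (fun ω => ((fun s : Fin t => (A s ω, X s ω)), A t ω)) (armKernel F t) P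

/-- The committing rule: go through the arms in order, and pull the first one among the first
`K - 1` arms whose number of pulls `n i` is still below `⌊T a i⌋`; if there is none, pull the last
arm. (An arm that the exploration has pulled at least `T a i` times is skipped.) -/
def CommitsTo (T : ℕ) (a : Fin K → ℝ) (n : Fin K → ℕ) (i : Fin K) : Prop :=
  (∀ j < i, ⌊(T : ℝ) * a j⌋₊ ≤ n j) ∧ ((i : ℕ) + 1 = K ∨ n i < ⌊(T : ℝ) * a i⌋₊)

/-- The actions follow PM-ETC-M with horizon `T`, distortion function `h`, discretization level `ε`
and `m` exploration pulls per arm: during the first `K m` rounds each arm is pulled `m` times,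
in some fixed order; then a maximizer `ahat` over the discretized simplex of the preference metric
of the mixture of the empirical distributions is chosen (ties are broken arbitrarily), and the
committing rule tracks it until the horizon. -/
def FollowsETC [MeasurableSpace S] (P : Measure S) (h : ℝ → ℝ) (ε : ℝ) (T m : ℕ)
    (A : ℕ → S → Fin K) (X : ℕ → S → ℝ) : Prop :=
  ∃ (sched : ℕ → Fin K) (ahat : S → Fin K → ℝ),
    (∀ i, ((Finset.range (K * m)).filter fun s => sched s = i).card = m) ∧
    ∀ᵐ ω ∂P,
      (∀ t < T, t < K * m → A t ω = sched t) ∧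
      ahat ω ∈ argmaxOn (fun a => V h a (empirical A X (K * m) ω)) (discSimplex K ε) ∧
      ∀ t < T, K * m ≤ t → CommitsTo T (ahat ω) (pulls A t ω) (A t ω)

/-- The regret at horizon `T`, relative to the mixing coefficients `αstar` of the oracle. -/
def regret [MeasurableSpace S] (P : Measure S) (F : Fin K → Measure ℝ) (h : ℝ → ℝ)
    (αstar : Fin K → ℝ) (T : ℕ) (A : ℕ → S → Fin K) : ℝ :=
  V h αstar F - ∫ ω, V h (fun i => (pulls A T ω i : ℝ) / T) F ∂P

end Interaction

end PMBandit

end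

/-!
The Wasserstein distance is bounded by the `L¹` distance of the distribution functions, by the
quantile coupling (`W1_le_of_cdfDist_le`). Everything about Wasserstein distances is reduced to this:
mixtures of uniformly close arms are close, and since sub-Gaussian arms are within bounded distance
of the point mass at `0`, mixing is Lipschitz in the coefficients; hence `W` is the supremum of a
bounded set, and `V` is Hölder continuous in the coefficients with constant `L W ^ q`.

**Estimation.** Let `x = (δ₁₂ / (2 K L)) ^ (1 / q)`, so that a Wasserstein error of `x` per arm changes
`V` by at most `L x ^ q = δ₁₂ / (2 K) ≤ δ₁₂ / 4`; then the empirical maximizer is the maximizer `a₁`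
(`eq_of_mem_argmaxOn`). The empirical distribution of `m` samples satisfies
`P(∫ |F̂ - F| ≥ x) ≤ 2 exp (- m x² / 640)` for `x ≤ 12`
(`IsOneSubGaussian.measure_le_lintegral_cdfDeviation_le`): by Jensen's inequality for the
Cauchy density `p`, the exponential `exp (l m ∫ |F̂ - F|)` is at most `∫ p exp (l m |F̂ - F| / p)`; by
Tonelli's theorem and independence, its expectation involves for each `t` only the moment generating
function of an indicator whose probability is at most `2 exp (- t² / 2)`, and this Gaussian tail
absorbs `p⁻² exp (l / p)` for small `l`. The restriction `x ≤ 12` holds since all gaps between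
mixtures of sub-Gaussian arms are at most `L 12 ^ q`. Since `m x²` exceeds `640 log (2 K T)`, all
arms are estimated well with probability at least `1 - 1 / T`. Independence of the rewards in the
exploration phase follows from the conditional distributions, as the actions are deterministic there
(`IsInteraction.lintegral_prod`).

**Tracking.** Once the algorithm commits to `a₁`, the proportions of pulls end up within `ℓ¹` distance
`2 (K m + K) / T ≤ 3 N / T` of `a₁` (`sum_abs_pulls_sub_le`), because an arm can exceed its target
only by its pulls in the exploration phase, and the last arm by the rounding of the others.

Outside of the good event the loss is at most `L (2 W) ^ q`, which contributes at most
`L (2 W) ^ q / T ≤ L (3 W N / T) ^ q`. If `T ≤ 3 N / 2`, which includes the case that the horizon cuts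
the exploration phase short, the bound exceeds the trivial one. Altogether the loss with respect to
`a₁` is at most `2 L (3 W N / T) ^ q`, and `2 ≤ K`.
-/

namespace PMBandit

/-! ### The Wasserstein distance is at most the `L¹` distance of the distribution functions -/

/-- The (lower) quantile function of `μ`; only its values at levels in `(0, 1)` are meaningful. -/
noncomputable def quantile (μ : Measure ℝ) (u : ℝ) : ℝ :=
  sInf {x | u ≤ cdf μ x}

/-- On `(0, 1)` the quantile function and the distribution function form a Galois connection. -/
lemma quantile_le_iff (μ : Measure ℝ) {u : ℝ} (hu : u ∈ Ioo (0 : ℝ) 1) (x : ℝ) :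
    quantile μ u ≤ x ↔ u ≤ cdf μ x := by
  have hne : {x | u ≤ cdf μ x}.Nonempty := by
    obtain ⟨y, hy⟩ := ((tendsto_cdf_atTop μ).eventually (lt_mem_nhds hu.2)).exists
    exact ⟨y, hy.le⟩
  have hbdd : BddBelow {x | u ≤ cdf μ x} := by
    obtain ⟨y, hy⟩ := ((tendsto_cdf_atBot μ).eventually (gt_mem_nhds hu.1)).exists
    refine ⟨y, fun z hz => ?_⟩
    by_contra! hzy
    exact absurd (hz.trans (monotone_cdf μ hzy.le)) (not_le.2 hy)
  constructor
  · intro hx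
    -- by right continuity, the infimum is attained
    have hmem : u ≤ cdf μ (quantile μ u) := by
      have hcont : Tendsto (cdf μ) (nhdsWithin (quantile μ u) (Ioi (quantile μ u)))
          (nhds (cdf μ (quantile μ u))) :=
        ((cdf μ).right_continuous _).mono_left (nhdsWithin_mono _ Ioi_subset_Ici_self)
      refine ge_of_tendsto hcont ?_
      filter_upwards [self_mem_nhdsWithin] with y hy
      obtain ⟨z, hz, hzy⟩ := exists_lt_of_csInf_lt hne hy
      exact le_trans hz (monotone_cdf μ hzy.le)
    exact hmem.trans (monotone_cdf μ hx)
  · intro hx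
    exact csInf_le hbdd hx

lemma aemeasurable_quantile (μ : Measure ℝ) :
    AEMeasurable (quantile μ) (volume.restrict (Ioo 0 1)) := by
  refine aemeasurable_restrict_of_monotoneOn measurableSet_Ioo fun u hu v hv huv => ?_
  rw [quantile_le_iff μ hu]
  exact huv.trans ((quantile_le_iff μ hv _).1 le_rfl)

/-- Inverse transform sampling: the quantile function maps the uniform distribution to `μ`. -/
lemma map_quantile (μ : Measure ℝ) [IsProbabilityMeasure μ] :
    (volume.restrict (Ioo 0 1)).map (quantile μ) = μ := by
  have : IsFiniteMeasure (volume.restrict (Ioo (0 : ℝ) 1)) := ⟨by simp⟩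
  refine Measure.ext_of_Iic _ _ fun x => ?_
  rw [Measure.map_apply_of_aemeasurable (aemeasurable_quantile μ) measurableSet_Iic,
    Measure.restrict_apply' measurableSet_Ioo, ← ofReal_cdf μ x]
  have hset : quantile μ ⁻¹' Iic x ∩ Ioo 0 1 = {u | u ∈ Ioo (0 : ℝ) 1 ∧ u ≤ cdf μ x} := by
    ext u
    simp only [mem_inter_iff, mem_preimage, mem_Iic, mem_ofPred_eq]
    constructor
    · rintro ⟨h1, h2⟩
      exact ⟨h2, (quantile_le_iff μ h2 x).1 h1⟩
    · rintro ⟨h1, h2⟩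
      exact ⟨(quantile_le_iff μ h1 x).2 h2, h1⟩
  rw [hset]
  have h1 := cdf_le_one μ x
  refine le_antisymm ?_ ?_
  · calc _ ≤ volume (Ioc 0 (cdf μ x)) := measure_mono fun u hu => ⟨hu.1.1, hu.2⟩
      _ = _ := by rw [Real.volume_Ioc, sub_zero]
  · calc _ = volume (Ioo 0 (cdf μ x)) := by rw [Real.volume_Ioo, sub_zero]
      _ ≤ volume {u | u ∈ Ioo (0 : ℝ) 1 ∧ u ≤ cdf μ x} :=
        measure_mono fun u hu => ⟨⟨hu.1, hu.2.trans_le h1⟩, hu.2.le⟩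

/-- The `L¹` distance of the distribution functions of two measures. -/
noncomputable def cdfDist (μ ν : Measure ℝ) : ENNReal :=
  ∫⁻ t, ENNReal.ofReal |cdf μ t - cdf ν t|

lemma cdfDist_comm (μ ν : Measure ℝ) : cdfDist μ ν = cdfDist ν μ := by
  simp only [cdfDist, abs_sub_comm]

lemma measurable_cdf (μ : Measure ℝ) : Measurable (cdf μ) := (monotone_cdf μ).measurable

/-- The distance of two reals is the length of the set of levels that separate them. -/
lemma edist_eq_volume (a b : ℝ) : edist a b = volume {t : ℝ | ¬ (a ≤ t ↔ b ≤ t)} := by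
  have key : ∀ a b : ℝ, a ≤ b → edist a b = volume {t : ℝ | ¬ (a ≤ t ↔ b ≤ t)} := by
    intro a b hab
    have : {t : ℝ | ¬ (a ≤ t ↔ b ≤ t)} = Ico a b := by
      ext t
      simp only [mem_ofPred_eq, mem_Ico]
      grind
    rw [this, Real.volume_Ico, edist_comm, edist_dist, Real.dist_eq, abs_of_nonneg (by linarith)]
  rcases le_total a b with hab | hab
  · exact key a b hab
  · rw [edist_comm, key b a hab]
    simp only [iff_comm]

/-- The cost of the quantile coupling, computed by Fubini's theorem from the levels that separate
the two quantile functions. -/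
lemma lintegral_edist_quantile_le (μ ν : Measure ℝ) :
    ∫⁻ u in Ioo 0 1, edist (quantile μ u) (quantile ν u) ≤ cdfDist μ ν := by
  set E : Set (ℝ × ℝ) := {p | ¬ (p.1 ≤ cdf μ p.2 ↔ p.1 ≤ cdf ν p.2)} with hE
  have hEm : MeasurableSet E := by
    have h1 : MeasurableSet {p : ℝ × ℝ | p.1 ≤ cdf μ p.2} :=
      measurableSet_le measurable_fst ((measurable_cdf μ).comp measurable_snd)
    have h2 : MeasurableSet {p : ℝ × ℝ | p.1 ≤ cdf ν p.2} :=
      measurableSet_le measurable_fst ((measurable_cdf ν).comp measurable_snd)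
    exact (h1.iff h2).compl
  calc ∫⁻ u in Ioo 0 1, edist (quantile μ u) (quantile ν u)
      = ∫⁻ u in Ioo 0 1, volume (Prod.mk u ⁻¹' E) := by
        refine setLIntegral_congr_fun measurableSet_Ioo fun u hu => ?_
        simp only [edist_eq_volume, quantile_le_iff _ hu]
        rfl
    _ = ((volume.restrict (Ioo 0 1)).prod volume) E := (Measure.prod_apply hEm).symm
    _ = ∫⁻ t, (volume.restrict (Ioo 0 1)) ((fun u => (u, t)) ⁻¹' E) :=
        Measure.prod_apply_symm hEm
    _ ≤ cdfDist μ ν := by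
        refine lintegral_mono fun t => ?_
        rw [abs_sub_comm, ← Real.volume_uIoc]
        refine (Measure.restrict_apply_le _ _).trans (measure_mono fun u hu => ?_)
        simp only [hE, mem_preimage, mem_ofPred_eq] at hu
        rw [mem_uIoc]
        grind

/-- The quantile coupling bounds the Wasserstein distance by the `L¹` distance of the distribution
functions. (The two are equal, but only this bound is needed.) -/
lemma W1_le_of_cdfDist_le {μ ν : Measure ℝ} [IsProbabilityMeasure μ] [IsProbabilityMeasure ν]
    {c : ℝ} (hc : 0 ≤ c) (hle : cdfDist μ ν ≤ ENNReal.ofReal c) : W1 μ ν ≤ c := by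
  have hμ := aemeasurable_quantile μ
  have hν := aemeasurable_quantile ν
  set γ : Measure (ℝ × ℝ) :=
    (volume.restrict (Ioo 0 1)).map fun u => (quantile μ u, quantile ν u) with hγ
  have hfst : γ.map Prod.fst = μ := by
    rw [hγ, AEMeasurable.map_map_of_aemeasurable measurable_fst.aemeasurable (hμ.prodMk hν)]
    exact map_quantile μ
  have hsnd : γ.map Prod.snd = ν := by
    rw [hγ, AEMeasurable.map_map_of_aemeasurable measurable_snd.aemeasurable (hμ.prodMk hν)]
    exact map_quantile ν
  refine ENNReal.toReal_le_of_le_ofReal hc ((iInf_le _ ⟨γ, hfst, hsnd⟩).trans ?_)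
  rw [lintegral_map' (by fun_prop) (hμ.prodMk hν)]
  exact (lintegral_edist_quantile_le μ ν).trans hle

/-! ### Mixtures -/

section Mixtures

variable {K : ℕ} {a b : Fin K → ℝ} {F G : Fin K → Measure ℝ}

lemma isProbabilityMeasure_mix [∀ i, IsProbabilityMeasure (F i)]
    (ha : a ∈ stdSimplex ℝ (Fin K)) : IsProbabilityMeasure (mix a F) := by
  constructor
  simp only [mix, Measure.coe_finsetSum, Finset.sum_apply, Measure.smul_apply, measure_univ,
    smul_eq_mul, mul_one]
  rw [← ENNReal.ofReal_sum_of_nonneg fun i _ => ha.1 i, ha.2, ENNReal.ofReal_one]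

lemma mix_mem_P1 {Ω : Set ℝ} (ha : a ∈ stdSimplex ℝ (Fin K)) (hF : ∀ i, F i ∈ P1 Ω) :
    mix a F ∈ P1 Ω := by
  have : ∀ i, IsProbabilityMeasure (F i) := fun i => (hF i).1
  refine ⟨isProbabilityMeasure_mix ha, ?_, ?_⟩
  · simp [mix, (hF _).2.1]
  · rw [mix, integrable_finsetSum_measure]
    exact fun i _ => (hF i).2.2.smul_measure ENNReal.ofReal_ne_top

lemma cdf_mix [∀ i, IsProbabilityMeasure (F i)] (ha : a ∈ stdSimplex ℝ (Fin K)) (t : ℝ) :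
    cdf (mix a F) t = ∑ i, a i * cdf (F i) t := by
  have := isProbabilityMeasure_mix (F := F) ha
  simp only [cdf_eq_real]
  rw [measureReal_def, mix]
  simp only [Measure.coe_finsetSum, Finset.sum_apply, Measure.smul_apply, smul_eq_mul]
  rw [ENNReal.toReal_sum fun i _ => ENNReal.mul_ne_top ENNReal.ofReal_ne_top (measure_ne_top _ _)]
  exact Finset.sum_congr rfl fun i _ => by
    rw [ENNReal.toReal_mul, ENNReal.toReal_ofReal (ha.1 i), measureReal_def]

/-- A pointwise bound of a function by a nonnegative combination of functions with integrals at
most `c` bounds its integral. -/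
lemma lintegral_ofReal_le_of_le_sum {f : ℝ → ℝ} {w : Fin K → ℝ} {g : Fin K → ℝ → ℝ} {c : ℝ}
    (hc : 0 ≤ c) (hw : ∀ i, 0 ≤ w i) (hg : ∀ i, Measurable (g i)) (hg0 : ∀ i t, 0 ≤ g i t)
    (hfg : ∀ t, f t ≤ ∑ i, w i * g i t)
    (hint : ∀ i, ∫⁻ t, ENNReal.ofReal (g i t) ≤ ENNReal.ofReal c) :
    ∫⁻ t, ENNReal.ofReal (f t) ≤ ENNReal.ofReal (c * ∑ i, w i) :=
  calc ∫⁻ t, ENNReal.ofReal (f t)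
      ≤ ∫⁻ t, ∑ i, ENNReal.ofReal (w i) * ENNReal.ofReal (g i t) := by
        refine lintegral_mono fun t => (ENNReal.ofReal_le_ofReal (hfg t)).trans_eq ?_
        rw [ENNReal.ofReal_sum_of_nonneg fun i _ => mul_nonneg (hw i) (hg0 i t)]
        exact Finset.sum_congr rfl fun i _ => ENNReal.ofReal_mul (hw i)
    _ = ∑ i, ENNReal.ofReal (w i) * ∫⁻ t, ENNReal.ofReal (g i t) := by
        rw [lintegral_finsetSum _ fun i _ => by fun_prop]
        exact Finset.sum_congr rfl fun i _ => lintegral_const_mul _ (by fun_prop)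
    _ ≤ ∑ i, ENNReal.ofReal (w i) * ENNReal.ofReal c := by gcongr; exact hint _
    _ = ENNReal.ofReal (c * ∑ i, w i) := by
        rw [Finset.mul_sum, ENNReal.ofReal_sum_of_nonneg fun i _ => mul_nonneg hc (hw i)]
        exact Finset.sum_congr rfl fun i _ => by
          rw [mul_comm c, ENNReal.ofReal_mul (hw i)]

lemma W1_mix_le_of_cdfDist_le [∀ i, IsProbabilityMeasure (F i)] [∀ i, IsProbabilityMeasure (G i)]
    (ha : a ∈ stdSimplex ℝ (Fin K)) {c : ℝ} (hc : 0 ≤ c)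
    (h : ∀ i, cdfDist (F i) (G i) ≤ ENNReal.ofReal c) : W1 (mix a F) (mix a G) ≤ c := by
  have := isProbabilityMeasure_mix (F := F) ha
  have := isProbabilityMeasure_mix (F := G) ha
  refine W1_le_of_cdfDist_le hc ?_
  have := lintegral_ofReal_le_of_le_sum (f := fun t => |cdf (mix a F) t - cdf (mix a G) t|)
    (g := fun i t => |cdf (F i) t - cdf (G i) t|) hc ha.1
    (fun i => ((measurable_cdf _).sub (measurable_cdf _)).abs) (fun i t => abs_nonneg _)
    (fun t => ?_) h
  · rwa [ha.2, mul_one] at this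
  · rw [cdf_mix ha, cdf_mix ha, ← Finset.sum_sub_distrib]
    refine (Finset.abs_sum_le_sum_abs _ _).trans_eq (Finset.sum_congr rfl fun i _ => ?_)
    rw [← mul_sub, abs_mul, abs_of_nonneg (ha.1 i)]

/-- If all arms are within distance `c` of the point mass at `0`, then the mixture depends on its
coefficients in a Lipschitz way. -/
lemma W1_mix_le_mul_sum [∀ i, IsProbabilityMeasure (F i)] (ha : a ∈ stdSimplex ℝ (Fin K))
    (hb : b ∈ stdSimplex ℝ (Fin K)) {c : ℝ} (hc : 0 ≤ c)
    (h : ∀ i, cdfDist (F i) (Measure.dirac 0) ≤ ENNReal.ofReal c) :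
    W1 (mix a F) (mix b F) ≤ c * ∑ i, |a i - b i| := by
  have := isProbabilityMeasure_mix (F := F) ha
  have := isProbabilityMeasure_mix (F := F) hb
  refine W1_le_of_cdfDist_le (mul_nonneg hc (Finset.sum_nonneg fun i _ => abs_nonneg _)) ?_
  refine lintegral_ofReal_le_of_le_sum (g := fun i t => |cdf (F i) t - cdf (Measure.dirac 0) t|)
    hc (fun i => abs_nonneg _)
    (fun i => ((measurable_cdf _).sub (measurable_cdf _)).abs) (fun i t => abs_nonneg _)
    (fun t => ?_) h
  have hsum : cdf (mix a F) t - cdf (mix b F) t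
      = ∑ i, (a i - b i) * (cdf (F i) t - cdf (Measure.dirac 0) t) := by
    rw [cdf_mix ha, cdf_mix hb]
    simp only [mul_sub, sub_mul, Finset.sum_sub_distrib, ← Finset.sum_mul]
    rw [ha.2, hb.2]
    ring
  rw [hsum]
  exact (Finset.abs_sum_le_sum_abs _ _).trans_eq (Finset.sum_congr rfl fun i _ => abs_mul _ _)

lemma W_nonneg (F : Fin K → Measure ℝ) : 0 ≤ W F := by
  refine Real.sSup_nonneg ?_
  rintro r ⟨α, -, β, -, -, rfl⟩
  exact div_nonneg ENNReal.toReal_nonneg (Finset.sum_nonneg fun i _ => abs_nonneg _)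

lemma W1_mix_le_W_mul_sum [∀ i, IsProbabilityMeasure (F i)] (ha : a ∈ stdSimplex ℝ (Fin K))
    (hb : b ∈ stdSimplex ℝ (Fin K)) {c : ℝ} (hc : 0 ≤ c)
    (h : ∀ i, cdfDist (F i) (Measure.dirac 0) ≤ ENNReal.ofReal c) :
    W1 (mix a F) (mix b F) ≤ W F * ∑ i, |a i - b i| := by
  have hpos : ∀ α β : Fin K → ℝ, α ≠ β → 0 < ∑ i, |α i - β i| := by
    intro α β hαβ
    obtain ⟨i, hi⟩ := Function.ne_iff.1 hαβ
    exact Finset.sum_pos' (fun i _ => abs_nonneg _)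
      ⟨i, Finset.mem_univ i, abs_pos.2 (sub_ne_zero.2 hi)⟩
  rcases eq_or_ne a b with rfl | hab
  · simpa using W1_mix_le_mul_sum ha ha hc h
  · rw [← div_le_iff₀ (hpos a b hab)]
    refine le_csSup ⟨c, ?_⟩ ⟨a, ha, b, hb, hab, rfl⟩
    rintro r ⟨α, hα, β, hβ, hαβ, rfl⟩
    rw [div_le_iff₀ (hpos α β hαβ)]
    exact W1_mix_le_mul_sum hα hβ hc h

end Mixtures

/-- The `ℓ¹`-diameter of the simplex is at most `2`. -/
lemma sum_abs_sub_le_two {K : ℕ} {a b : Fin K → ℝ} (ha : a ∈ stdSimplex ℝ (Fin K))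
    (hb : b ∈ stdSimplex ℝ (Fin K)) : ∑ i, |a i - b i| ≤ 2 :=
  calc ∑ i, |a i - b i| ≤ ∑ i, (a i + b i) := Finset.sum_le_sum fun i _ => by
        rw [abs_le]
        constructor <;> linarith [ha.1 i, hb.1 i]
    _ = 2 := by rw [Finset.sum_add_distrib, ha.2, hb.2]; norm_num

/-! ### Sub-Gaussian tails -/

section SubGaussian

variable {G : Measure ℝ} [IsProbabilityMeasure G]

lemma IsOneSubGaussian.one_sub_cdf_le (hG : IsOneSubGaussian G) {t : ℝ} (ht : 0 ≤ t) :
    1 - cdf G t ≤ 2 * Real.exp (-t ^ 2 / 2) := by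
  refine le_trans ?_ (hG t ht)
  rw [cdf_eq_real, ← probReal_compl_eq_one_sub measurableSet_Iic]
  refine measureReal_mono fun x hx => ?_
  simp only [mem_compl_iff, mem_Iic, not_le] at hx
  exact hx.trans_le (le_abs_self x)

lemma IsOneSubGaussian.cdf_le (hG : IsOneSubGaussian G) {t : ℝ} (ht : t < 0) :
    cdf G t ≤ 2 * Real.exp (-t ^ 2 / 2) := by
  -- the tail bound is about strict inequalities: let `s` increase to `-t`
  have hlim : Tendsto (fun s : ℝ => 2 * Real.exp (-s ^ 2 / 2)) (nhdsWithin (-t) (Iio (-t)))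
      (nhds (2 * Real.exp (-t ^ 2 / 2))) := by
    have hc : Continuous fun s : ℝ => 2 * Real.exp (-s ^ 2 / 2) := by fun_prop
    have := (hc.tendsto (-t)).mono_left (nhdsWithin_le_nhds (s := Iio (-t)))
    rwa [neg_sq t] at this
  refine ge_of_tendsto hlim ?_
  filter_upwards [Ioo_mem_nhdsLT (show (0 : ℝ) < -t by linarith)] with s hs
  refine le_trans ?_ (hG s hs.1.le)
  rw [cdf_eq_real]
  refine measureReal_mono fun x hx => ?_
  have hx' : x ≤ t := hx
  exact (show s < -x by linarith [hs.2]).trans_le (neg_le_abs x)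

lemma cdf_dirac_zero (t : ℝ) : cdf (Measure.dirac (0 : ℝ)) t = if 0 ≤ t then 1 else 0 := by
  rw [cdf_eq_real, measureReal_def, Measure.dirac_apply' _ measurableSet_Iic]
  by_cases ht : 0 ≤ t <;> simp [ht]

lemma IsOneSubGaussian.abs_cdf_sub_cdf_dirac_le (hG : IsOneSubGaussian G) (t : ℝ) :
    |cdf G t - cdf (Measure.dirac 0) t| ≤ 2 * Real.exp (-t ^ 2 / 2) := by
  rw [cdf_dirac_zero]
  split_ifs with ht
  · rw [abs_sub_comm, abs_of_nonneg (by linarith [cdf_le_one G t])]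
    exact hG.one_sub_cdf_le ht
  · rw [sub_zero, abs_of_nonneg (cdf_nonneg G t)]
    exact hG.cdf_le (not_le.1 ht)

lemma lintegral_two_mul_exp_neg_sq_div_two_le :
    ∫⁻ t : ℝ, ENNReal.ofReal (2 * Real.exp (-t ^ 2 / 2)) ≤ ENNReal.ofReal 6 := by
  have h1 : ∀ t : ℝ, 2 * Real.exp (-t ^ 2 / 2) = 2 * Real.exp (-(1 / 2) * t ^ 2) := fun t => by
    congr 2; ring
  simp only [h1]
  rw [← ofReal_integral_eq_lintegral_ofReal
    ((integrable_exp_neg_mul_sq (by norm_num)).const_mul 2) (ae_of_all _ fun t => by positivity),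
    integral_const_mul, integral_gaussian]
  refine ENNReal.ofReal_le_ofReal ?_
  have : √(Real.pi / (1 / 2)) ≤ 3 := by
    rw [Real.sqrt_le_left (by norm_num)]
    linarith [Real.pi_lt_four]
  linarith

lemma IsOneSubGaussian.cdfDist_dirac_zero_le (hG : IsOneSubGaussian G) :
    cdfDist G (Measure.dirac 0) ≤ ENNReal.ofReal 6 :=
  (lintegral_mono fun t => ENNReal.ofReal_le_ofReal (hG.abs_cdf_sub_cdf_dirac_le t)).trans
    lintegral_two_mul_exp_neg_sq_div_two_le

lemma IsOneSubGaussian.integrable (hG : IsOneSubGaussian G) : Integrable (fun x : ℝ => x) G := by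
  refine ⟨by fun_prop, ?_⟩
  rw [hasFiniteIntegral_iff_norm]
  simp only [Real.norm_eq_abs]
  rw [lintegral_eq_lintegral_meas_lt G (ae_of_all _ fun x => abs_nonneg x) (by fun_prop)]
  calc ∫⁻ t in Ioi 0, G {x | t < |x|}
      ≤ ∫⁻ t in Ioi (0 : ℝ), ENNReal.ofReal (2 * Real.exp (-t ^ 2 / 2)) := by
        refine setLIntegral_mono (by fun_prop) fun t ht => ?_
        rw [← ofReal_measureReal]
        exact ENNReal.ofReal_le_ofReal (hG t (le_of_lt ht))
    _ ≤ ∫⁻ t : ℝ, ENNReal.ofReal (2 * Real.exp (-t ^ 2 / 2)) := setLIntegral_le_lintegral _ _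
    _ ≤ ENNReal.ofReal 6 := lintegral_two_mul_exp_neg_sq_div_two_le
    _ < ⊤ := ENNReal.ofReal_lt_top

end SubGaussian


/-! ### Concentration of the empirical distribution function in `L¹` -/

lemma exp_sub_one_sub_le (u : ℝ) : Real.exp u - 1 - u ≤ u ^ 2 * Real.exp |u| := by
  have h1 : Real.exp u - 1 ≤ u * Real.exp u := by
    have h2 : (1 - u) * Real.exp u ≤ Real.exp (-u) * Real.exp u :=
      mul_le_mul_of_nonneg_right (Real.one_sub_le_exp_neg u) (Real.exp_pos u).le
    rw [← Real.exp_add, neg_add_cancel, Real.exp_zero] at h2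
    linarith
  rcases le_total 0 u with hu | hu
  · rw [abs_of_nonneg hu]
    have h4 := mul_le_mul_of_nonneg_left h1 hu
    have h5 : u * (Real.exp u - 1) ≤ u ^ 2 * Real.exp u := by nlinarith
    nlinarith [Real.add_one_le_exp u]
  · have h3 : Real.exp u - 1 - u ≤ u * (Real.exp u - 1) := by linarith
    have h4 : u * (Real.exp u - 1) ≤ u ^ 2 := by nlinarith [Real.add_one_le_exp u]
    have h5 : u ^ 2 ≤ u ^ 2 * Real.exp |u| :=
      le_mul_of_one_le_right (sq_nonneg u) (Real.one_le_exp (abs_nonneg u))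
    linarith

/-- A sub-Poissonian bound on the moment generating function of a centred indicator. Its exponent
is proportional to the probability of the event, which is what makes the tails negligible. -/
lemma lintegral_exp_indicator_le {G : Measure ℝ} [IsProbabilityMeasure G] {B : Set ℝ}
    (hB : MeasurableSet B) (u : ℝ) :
    ∫⁻ x, ENNReal.ofReal (Real.exp (u * (B.indicator 1 x - G.real B))) ∂G
      ≤ ENNReal.ofReal (Real.exp (G.real B * (u ^ 2 * Real.exp |u|))) := by
  set θ := G.real B with hθ
  have hθ0 : 0 ≤ θ := measureReal_nonneg
  have hsplit : ∀ x, Real.exp (u * (B.indicator 1 x - θ))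
      = B.indicator (fun _ => Real.exp (u * (1 - θ)) - Real.exp (-(u * θ))) x
        + Real.exp (-(u * θ)) := by
    intro x
    by_cases hx : x ∈ B
    · simp [hx]
    · simp [hx]
  have hint : Integrable (B.indicator
      (fun _ : ℝ => Real.exp (u * (1 - θ)) - Real.exp (-(u * θ)))) G :=
    (integrable_const _).indicator hB
  simp only [hsplit]
  have hint' : Integrable (fun x => B.indicator
      (fun _ : ℝ => Real.exp (u * (1 - θ)) - Real.exp (-(u * θ))) x + Real.exp (-(u * θ))) G :=
    hint.add (integrable_const _)
  rw [← ofReal_integral_eq_lintegral_ofReal hint' (ae_of_all _ fun x => by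
    simp only [← hsplit]
    exact (Real.exp_pos _).le)]
  refine ENNReal.ofReal_le_ofReal ?_
  rw [integral_add hint (integrable_const _), integral_indicator_const _ hB, integral_const,
    probReal_univ, ← hθ, smul_eq_mul, one_smul]
  calc θ * (Real.exp (u * (1 - θ)) - Real.exp (-(u * θ))) + Real.exp (-(u * θ))
      = (θ * (Real.exp u - 1) + 1) * Real.exp (-(u * θ)) := by
        rw [show u * (1 - θ) = u + -(u * θ) by ring, Real.exp_add]
        ring
    _ ≤ Real.exp (θ * (Real.exp u - 1)) * Real.exp (-(u * θ)) := by
        gcongr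
        exact Real.add_one_le_exp _
    _ = Real.exp (θ * (Real.exp u - 1 - u)) := by
        rw [← Real.exp_add]
        congr 1
        ring
    _ ≤ Real.exp (θ * (u ^ 2 * Real.exp |u|)) := by
        gcongr
        exact exp_sub_one_sub_le u

/-- The reciprocal of the standard Cauchy density, which serves as a weight function. -/
noncomputable def cauchyWeight (t : ℝ) : ℝ := Real.pi * (1 + t ^ 2)

lemma cauchyWeight_pos (t : ℝ) : 0 < cauchyWeight t := by
  unfold cauchyWeight
  positivity

lemma measurable_cauchyWeight : Measurable cauchyWeight := by
  unfold cauchyWeight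
  fun_prop

lemma lintegral_inv_cauchyWeight :
    ∫⁻ t, ENNReal.ofReal (cauchyWeight t)⁻¹ = 1 := by
  have h1 : ∀ t, (cauchyWeight t)⁻¹ = Real.pi⁻¹ * (1 + t ^ 2)⁻¹ := fun t => by
    rw [cauchyWeight, mul_inv]
  simp only [h1]
  rw [← ofReal_integral_eq_lintegral_ofReal (integrable_inv_one_add_sq.const_mul _)
    (ae_of_all _ fun t => by positivity), integral_const_mul, integral_univ_inv_one_add_sq,
    inv_mul_cancel₀ Real.pi_ne_zero, ENNReal.ofReal_one]

/-- The Gaussian tail absorbs the Cauchy weight, even inside the exponential, if the scale `l`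
is small. -/
lemma tail_mul_exp_weight_le {l t : ℝ} (hl : l * Real.pi ≤ 1 / 8) :
    2 * Real.exp (-t ^ 2 / 2) * ((l * cauchyWeight t) ^ 2 * Real.exp (l * cauchyWeight t))
      ≤ 160 * l ^ 2 := by
  set z := 1 + t ^ 2 with hz
  have hz0 : 0 ≤ z := by positivity
  have hw : l * cauchyWeight t = l * Real.pi * z := by rw [cauchyWeight]; ring
  have hpi : Real.pi ^ 2 ≤ 10 := by nlinarith [Real.pi_lt_d2, Real.pi_gt_three]
  have h1 : z ≤ 16 / 3 * Real.exp (3 * z / 16 - 1) := by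
    nlinarith [Real.add_one_le_exp (3 * z / 16 - 1)]
  have h2 : z ^ 2 ≤ 256 / 9 * Real.exp (3 * z / 8 - 2) := by
    calc z ^ 2 ≤ (16 / 3 * Real.exp (3 * z / 16 - 1)) ^ 2 := by gcongr
      _ = 256 / 9 * Real.exp (3 * z / 8 - 2) := by
        rw [mul_pow, ← Real.exp_nat_mul]
        norm_num
        ring
  have hexp : Real.exp (-(3 / 2) : ℝ) ≤ 1 / 4 := by
    have : Real.exp (-(3 / 2) : ℝ) = Real.exp (-(3 / 4)) ^ 2 := by
      rw [← Real.exp_nat_mul]; norm_num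
    have h34 : Real.exp (-(3 / 4) : ℝ) ≤ 1 / 2 := by
      rw [Real.exp_neg, inv_le_comm₀ (Real.exp_pos _) (by norm_num)]
      nlinarith [Real.quadratic_le_exp_of_nonneg (show (0 : ℝ) ≤ 3 / 4 by norm_num)]
    rw [this]
    nlinarith [Real.exp_pos (-(3 / 4) : ℝ)]
  calc 2 * Real.exp (-t ^ 2 / 2) * ((l * cauchyWeight t) ^ 2 * Real.exp (l * cauchyWeight t))
      = 2 * l ^ 2 * Real.pi ^ 2 * z ^ 2 *
          (Real.exp (-t ^ 2 / 2) * Real.exp (l * Real.pi * z)) := by rw [hw]; ring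
    _ ≤ 2 * l ^ 2 * 10 * (256 / 9 * Real.exp (3 * z / 8 - 2)) *
          (Real.exp (-t ^ 2 / 2) * Real.exp (1 / 8 * z)) := by gcongr
    _ = 2 * l ^ 2 * 10 * (256 / 9) * (Real.exp (3 * z / 8 - 2) *
          (Real.exp (-t ^ 2 / 2) * Real.exp (1 / 8 * z))) := by ring
    _ = 2 * l ^ 2 * 10 * (256 / 9) * Real.exp (-(3 / 2)) := by
        rw [← Real.exp_add, ← Real.exp_add]
        congr 2
        rw [hz]
        ring
    _ ≤ 2 * l ^ 2 * 10 * (256 / 9) * (1 / 4) := by gcongr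
    _ ≤ 160 * l ^ 2 := by nlinarith [sq_nonneg l]

/-- The moment generating function of `1_{x ≤ t} - G(t)` at scale `±l / p(t)`, where `p` is the
Cauchy density, is bounded by that of a Gaussian, uniformly in `t`. -/
lemma IsOneSubGaussian.lintegral_exp_le {G : Measure ℝ} [IsProbabilityMeasure G]
    (hG : IsOneSubGaussian G) {l u t : ℝ} (hl : l * Real.pi ≤ 1 / 8)
    (hu : |u| = l * cauchyWeight t) :
    ∫⁻ x, ENNReal.ofReal (Real.exp (u * ((Iic t).indicator 1 x - cdf G t))) ∂G
      ≤ ENNReal.ofReal (Real.exp (160 * l ^ 2)) := by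
  rcases lt_or_ge t 0 with ht | ht
  · rw [cdf_eq_real]
    refine (lintegral_exp_indicator_le measurableSet_Iic u).trans (ENNReal.ofReal_le_ofReal ?_)
    refine Real.exp_le_exp.2 (le_trans ?_ (tail_mul_exp_weight_le (t := t) hl))
    rw [← sq_abs u, hu, ← cdf_eq_real]
    gcongr
    exact hG.cdf_le ht
  · -- on the right half line, pass to the complementary event
    have h1 : ∀ x : ℝ, u * ((Iic t).indicator 1 x - cdf G t)
        = -u * ((Ioi t).indicator 1 x - G.real (Ioi t)) := by
      intro x
      rw [← compl_Iic, probReal_compl_eq_one_sub measurableSet_Iic, ← cdf_eq_real]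
      by_cases hx : x ∈ Iic t
      · rw [indicator_of_mem hx, indicator_of_notMem (by simpa using hx), Pi.one_apply]
        ring
      · rw [indicator_of_notMem hx, indicator_of_mem (by simpa using hx), Pi.one_apply]
        ring
    simp only [h1]
    refine (lintegral_exp_indicator_le measurableSet_Ioi (-u)).trans
      (ENNReal.ofReal_le_ofReal ?_)
    refine Real.exp_le_exp.2 (le_trans ?_ (tail_mul_exp_weight_le (t := t) hl))
    rw [neg_sq, abs_neg, ← sq_abs u, hu, ← compl_Iic,
      probReal_compl_eq_one_sub measurableSet_Iic, ← cdf_eq_real]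
    gcongr
    exact hG.one_sub_cdf_le ht

/-- Jensen's inequality for the exponential function and the Cauchy distribution, in the form of a
tangent line argument: if `∫ D ≥ y`, then `∫ p exp(l D / p) ≥ exp(l y)`, where `p` is the Cauchy
density. -/
lemma exp_le_lintegral_exp_weight {D : ℝ → ℝ} (hD : Measurable D) (hD0 : ∀ t, 0 ≤ D t) {l y : ℝ}
    (hl : 0 ≤ l) (hy : 0 ≤ y) (hyD : ENNReal.ofReal y ≤ ∫⁻ t, ENNReal.ofReal (D t)) :
    ENNReal.ofReal (Real.exp (l * y)) ≤
      ∫⁻ t, ENNReal.ofReal ((cauchyWeight t)⁻¹ * Real.exp (l * cauchyWeight t * D t)) := by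
  have hw := measurable_cauchyWeight
  set c := l * y with hc
  have hc0 : 0 ≤ c := mul_nonneg hl hy
  have hpt : ∀ t, Real.exp c * (cauchyWeight t)⁻¹ + Real.exp c * l * D t
      ≤ (cauchyWeight t)⁻¹ * Real.exp (l * cauchyWeight t * D t)
        + Real.exp c * c * (cauchyWeight t)⁻¹ := by
    intro t
    have hp := cauchyWeight_pos t
    have h1 : Real.exp c * (1 + l * cauchyWeight t * D t - c)
        ≤ Real.exp (l * cauchyWeight t * D t) := by
      have h2 := Real.add_one_le_exp (l * cauchyWeight t * D t - c)
      rw [Real.exp_sub, le_div_iff₀ (Real.exp_pos c)] at h2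
      linarith
    have h3 := mul_le_mul_of_nonneg_left h1 (inv_pos.2 hp).le
    have h4 : (cauchyWeight t)⁻¹ * (Real.exp c * (1 + l * cauchyWeight t * D t - c))
        = Real.exp c * (cauchyWeight t)⁻¹ + Real.exp c * l * D t
          - Real.exp c * c * (cauchyWeight t)⁻¹ := by
      field_simp
    linarith
  have hint : ENNReal.ofReal (Real.exp c) + ENNReal.ofReal (Real.exp c * c)
      ≤ (∫⁻ t, ENNReal.ofReal ((cauchyWeight t)⁻¹ * Real.exp (l * cauchyWeight t * D t)))
        + ENNReal.ofReal (Real.exp c * c) := by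
    calc ENNReal.ofReal (Real.exp c) + ENNReal.ofReal (Real.exp c * c)
        ≤ ENNReal.ofReal (Real.exp c) * 1
          + ENNReal.ofReal (Real.exp c * l) * ∫⁻ t, ENNReal.ofReal (D t) := by
          rw [mul_one]
          gcongr
          rw [hc, ← mul_assoc, ENNReal.ofReal_mul (by positivity)]
          gcongr
      _ = ∫⁻ t, ENNReal.ofReal (Real.exp c * (cauchyWeight t)⁻¹ + Real.exp c * l * D t) := by
          rw [← lintegral_inv_cauchyWeight, ← lintegral_const_mul _ (by fun_prop),
            ← lintegral_const_mul _ (by fun_prop), ← lintegral_add_left (by fun_prop)]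
          refine lintegral_congr fun t => ?_
          have hp := cauchyWeight_pos t
          have := hD0 t
          rw [ENNReal.ofReal_add (by positivity) (by positivity),
            ENNReal.ofReal_mul (q := (cauchyWeight t)⁻¹) (by positivity),
            ENNReal.ofReal_mul (q := D t) (by positivity)]
      _ ≤ ∫⁻ t, ENNReal.ofReal ((cauchyWeight t)⁻¹ * Real.exp (l * cauchyWeight t * D t)
            + Real.exp c * c * (cauchyWeight t)⁻¹) :=
          lintegral_mono fun t => ENNReal.ofReal_le_ofReal (hpt t)
      _ = _ := by
          rw [← mul_one (ENNReal.ofReal (Real.exp c * c)), ← lintegral_inv_cauchyWeight, ← lintegral_const_mul _ (by fun_prop),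
            ← lintegral_add_right _ (by fun_prop)]
          refine lintegral_congr fun t => ?_
          have hp := cauchyWeight_pos t
          rw [ENNReal.ofReal_add (by positivity) (by positivity),
            ENNReal.ofReal_mul (p := Real.exp c * c) (by positivity)]
  exact (ENNReal.add_le_add_iff_right ENNReal.ofReal_ne_top).1 hint

/-- The deviation of the empirical distribution function of the samples `x s`, `s ∈ I`, from the
distribution function of `G`. -/
noncomputable def cdfDeviation (G : Measure ℝ) (I : Finset ℕ) (x : ℕ → ℝ) (t : ℝ) : ℝ :=
  ∑ s ∈ I, ((Iic t).indicator 1 (x s) - cdf G t)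

lemma measurable_cdfDeviation_uncurry {S : Type*} [MeasurableSpace S] (G : Measure ℝ)
    (I : Finset ℕ) {X : ℕ → S → ℝ} (hX : ∀ s, Measurable (X s)) :
    Measurable fun p : S × ℝ => cdfDeviation G I (fun s => X s p.1) p.2 := by
  unfold cdfDeviation
  refine Finset.measurable_sum _ fun s _ => ?_
  refine Measurable.sub ?_ ((measurable_cdf G).comp measurable_snd)
  have : (fun p : S × ℝ => (Iic p.2).indicator (1 : ℝ → ℝ) (X s p.1))
      = {p : S × ℝ | X s p.1 ≤ p.2}.indicator 1 := by
    ext p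
    simp [indicator_apply]
  rw [this]
  exact measurable_one.indicator
    (measurableSet_le ((hX s).comp measurable_fst) measurable_snd)

/-- The exponential of the deviation of the empirical distribution function at `t`, scaled by `a`
times the Cauchy weight, multiplied by the Cauchy density. -/
noncomputable def expDeviation (G : Measure ℝ) (I : Finset ℕ) (a : ℝ) (x : ℕ → ℝ) (t : ℝ) :
    ENNReal :=
  ENNReal.ofReal (cauchyWeight t)⁻¹ *
    ENNReal.ofReal (Real.exp (a * cauchyWeight t * cdfDeviation G I x t))

section Concentration

variable {S : Type*} [MeasurableSpace S] {P : Measure S} [IsProbabilityMeasure P] {G : Measure ℝ}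
  {I : Finset ℕ} {X : ℕ → S → ℝ}

lemma measurable_expDeviation_uncurry (a : ℝ) (hX : ∀ s, Measurable (X s)) :
    Measurable fun p : S × ℝ => expDeviation G I a (fun s => X s p.1) p.2 := by
  have hw := measurable_cauchyWeight
  have hm := measurable_cdfDeviation_uncurry G I hX
  unfold expDeviation
  fun_prop

lemma IsOneSubGaussian.lintegral_expDeviation_le [IsProbabilityMeasure G]
    (hG : IsOneSubGaussian G) (hX : ∀ s, Measurable (X s))
    (hprod : ∀ g : ℝ → ENNReal, Measurable g →
      ∫⁻ ω, ∏ s ∈ I, g (X s ω) ∂P = (∫⁻ x, g x ∂G) ^ I.card)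
    {a : ℝ} (ha : |a| * Real.pi ≤ 1 / 8) :
    ∫⁻ ω, (∫⁻ t, expDeviation G I a (fun s => X s ω) t) ∂P
      ≤ ENNReal.ofReal (Real.exp (I.card * (160 * a ^ 2))) := by
  have hw := measurable_cauchyWeight
  have hm := measurable_cdfDeviation_uncurry G I hX
  rw [lintegral_lintegral_swap (measurable_expDeviation_uncurry a hX).aemeasurable]
  calc ∫⁻ t, ∫⁻ ω, expDeviation G I a (fun s => X s ω) t ∂P ∂volume
      ≤ ∫⁻ t, ENNReal.ofReal (cauchyWeight t)⁻¹ *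
          ENNReal.ofReal (Real.exp (I.card * (160 * a ^ 2))) := by
        refine lintegral_mono fun t => ?_
        simp only [expDeviation]
        rw [lintegral_const_mul _ (by
          have := hm.comp (measurable_prodMk_right (y := t))
          simp only [Function.comp_def] at this
          fun_prop)]
        gcongr
        set u := a * cauchyWeight t with hu
        have hu' : |u| = |a| * cauchyWeight t := by
          rw [hu, abs_mul, abs_of_pos (cauchyWeight_pos t)]
        have hprod' : ∀ ω, ENNReal.ofReal
            (Real.exp (u * cdfDeviation G I (fun s => X s ω) t)) =
            ∏ s ∈ I, ENNReal.ofReal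
              (Real.exp (u * ((Iic t).indicator 1 (X s ω) - cdf G t))) := by
          intro ω
          rw [cdfDeviation, Finset.mul_sum, Real.exp_sum,
            ENNReal.ofReal_prod_of_nonneg fun s _ => (Real.exp_pos _).le]
        simp only [hprod']
        rw [hprod (fun x => ENNReal.ofReal
          (Real.exp (u * ((Iic t).indicator 1 x - cdf G t)))) (by
            have : Measurable ((Iic t).indicator (1 : ℝ → ℝ)) :=
              measurable_one.indicator measurableSet_Iic
            fun_prop), Real.exp_nat_mul, ENNReal.ofReal_pow (Real.exp_pos _).le, ← sq_abs a]
        gcongr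
        exact hG.lintegral_exp_le ha hu'
    _ = _ := by
        rw [lintegral_mul_const _ (by fun_prop), lintegral_inv_cauchyWeight, one_mul]

lemma ofReal_exp_mul_abs_le (l w d : ℝ) (hw : 0 ≤ w) :
    ENNReal.ofReal (w⁻¹ * Real.exp (l * w * |d|)) ≤
      ENNReal.ofReal w⁻¹ * ENNReal.ofReal (Real.exp (l * w * d))
        + ENNReal.ofReal w⁻¹ * ENNReal.ofReal (Real.exp (-l * w * d)) := by
  rw [ENNReal.ofReal_mul (inv_nonneg.2 hw)]
  rcases abs_cases d with ⟨h, -⟩ | ⟨h, -⟩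
  · rw [h]
    exact le_self_add
  · rw [h, show l * w * -d = -l * w * d by ring]
    exact le_add_self

/-- A large `L¹` deviation of the empirical distribution function makes the exponential of the
deviation large, for one of the two signs. -/
lemma exp_le_lintegral_expDeviation_add (hX : ∀ s, Measurable (X s)) {l y : ℝ}
    (hl : 0 ≤ l) (hy : 0 ≤ y) {ω : S}
    (hω : ENNReal.ofReal y ≤ ∫⁻ t, ENNReal.ofReal |cdfDeviation G I (fun s => X s ω) t|) :
    ENNReal.ofReal (Real.exp (l * y)) ≤ (∫⁻ t, expDeviation G I l (fun s => X s ω) t)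
      + ∫⁻ t, expDeviation G I (-l) (fun s => X s ω) t := by
  have hmω : Measurable fun t => cdfDeviation G I (fun s => X s ω) t :=
    (measurable_cdfDeviation_uncurry G I hX).comp measurable_prodMk_left
  have hΦω : Measurable fun t => expDeviation G I l (fun s => X s ω) t := by
    have hw := measurable_cauchyWeight
    unfold expDeviation
    fun_prop
  refine (exp_le_lintegral_exp_weight hmω.abs (fun t => abs_nonneg _) hl hy hω).trans ?_
  rw [← lintegral_add_left hΦω]
  exact lintegral_mono fun t => ofReal_exp_mul_abs_le _ _ _ (cauchyWeight_pos t).le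

/-- Concentration in `L¹` of the empirical distribution function of independent sub-Gaussian samples
around the distribution function. Independence enters as the product formula for the integral. -/
lemma IsOneSubGaussian.measure_le_lintegral_cdfDeviation_le [IsProbabilityMeasure G]
    (hG : IsOneSubGaussian G) (hX : ∀ s, Measurable (X s))
    (hprod : ∀ g : ℝ → ENNReal, Measurable g →
      ∫⁻ ω, ∏ s ∈ I, g (X s ω) ∂P = (∫⁻ x, g x ∂G) ^ I.card)
    {y : ℝ} (hy0 : 0 ≤ y) (hy : y ≤ 12) :
    P {ω | ENNReal.ofReal (I.card * y) ≤
        ∫⁻ t, ENNReal.ofReal |cdfDeviation G I (fun s => X s ω) t|}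
      ≤ ENNReal.ofReal (2 * Real.exp (-(I.card * y ^ 2 / 640))) := by
  -- the scale that optimizes the Chernoff bound
  set l := y / 320 with hl
  have hl0 : 0 ≤ l := by positivity
  have hlpi : |l| * Real.pi ≤ 1 / 8 := by
    have h1 : l ≤ 12 / 320 := by rw [hl]; linarith
    rw [abs_of_nonneg hl0]
    nlinarith [Real.pi_lt_d2, Real.pi_pos]
  have hm : ∀ a, Measurable fun ω => ∫⁻ t, expDeviation G I a (fun s => X s ω) t :=
    fun a => (measurable_expDeviation_uncurry a hX).lintegral_prod_right'
  set c := l * (I.card * y) with hc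
  have hsub : {ω | ENNReal.ofReal (I.card * y) ≤
        ∫⁻ t, ENNReal.ofReal |cdfDeviation G I (fun s => X s ω) t|}
      ⊆ {ω | ENNReal.ofReal (Real.exp c) ≤ (∫⁻ t, expDeviation G I l (fun s => X s ω) t)
        + ∫⁻ t, expDeviation G I (-l) (fun s => X s ω) t} :=
    fun ω hω => exp_le_lintegral_expDeviation_add hX hl0 (by positivity) hω
  have htotal : ENNReal.ofReal (Real.exp c) *
      P {ω | ENNReal.ofReal (I.card * y) ≤
        ∫⁻ t, ENNReal.ofReal |cdfDeviation G I (fun s => X s ω) t|}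
      ≤ ENNReal.ofReal (2 * Real.exp (I.card * (160 * l ^ 2))) := by
    refine (mul_le_mul_right (measure_mono hsub) _).trans
      ((mul_meas_ge_le_lintegral₀ ((hm l).add (hm (-l))).aemeasurable _).trans ?_)
    simp only [Pi.add_apply]
    rw [lintegral_add_left (hm l), two_mul, ENNReal.ofReal_add (by positivity) (by positivity)]
    refine add_le_add (hG.lintegral_expDeviation_le hX hprod hlpi) ?_
    rw [← neg_sq l]
    exact hG.lintegral_expDeviation_le hX hprod (by rwa [abs_neg])
  have hexp : 2 * Real.exp (-(I.card * y ^ 2 / 640))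
      = 2 * Real.exp (I.card * (160 * l ^ 2)) / Real.exp c := by
    rw [mul_div_assoc 2 (Real.exp _), ← Real.exp_sub]
    congr 2
    rw [hc, hl]
    ring
  rw [hexp, ENNReal.ofReal_div_of_pos (Real.exp_pos c),
    ENNReal.le_div_iff_mul_le (Or.inl (by simp [Real.exp_pos])) (Or.inl ENNReal.ofReal_ne_top),
    mul_comm]
  exact htotal

end Concentration


/-! ### Empirical measures -/

section SampleMeasure

/-- The empirical distribution of the samples `x s`, `s ∈ I`. -/
noncomputable def sampleMeasure (I : Finset ℕ) (x : ℕ → ℝ) : Measure ℝ :=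
  (I.card : ENNReal)⁻¹ • ∑ s ∈ I, Measure.dirac (x s)

variable {I : Finset ℕ} {x : ℕ → ℝ}

lemma isProbabilityMeasure_sampleMeasure (hI : I.Nonempty) :
    IsProbabilityMeasure (sampleMeasure I x) := by
  constructor
  simp only [sampleMeasure, Measure.smul_apply, Measure.coe_finsetSum, Finset.sum_apply,
    measure_univ, Finset.sum_const, nsmul_eq_mul, mul_one, smul_eq_mul]
  exact ENNReal.inv_mul_cancel (by simpa using hI.ne_empty) (ENNReal.natCast_ne_top _)

lemma sampleMeasure_mem_P1 (hI : I.Nonempty) {Ω : Set ℝ} (hx : ∀ s ∈ I, x s ∈ Ω) :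
    sampleMeasure I x ∈ P1 Ω := by
  refine ⟨isProbabilityMeasure_sampleMeasure hI, ?_, ?_⟩
  · simp only [sampleMeasure, Measure.smul_apply, Measure.coe_finsetSum, Finset.sum_apply,
      Measure.dirac_apply, smul_eq_mul]
    rw [Finset.sum_eq_zero fun s hs => indicator_of_notMem (by simpa using hx s hs) _, mul_zero]
  · refine Integrable.smul_measure ?_ (ENNReal.inv_ne_top.2 (by simpa using hI.ne_empty))
    rw [integrable_finsetSum_measure]
    exact fun s _ => integrable_dirac (by simp)

lemma cdf_sampleMeasure (hI : I.Nonempty) (t : ℝ) :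
    cdf (sampleMeasure I x) t = (I.card : ℝ)⁻¹ * ∑ s ∈ I, (Iic t).indicator 1 (x s) := by
  have := isProbabilityMeasure_sampleMeasure (x := x) hI
  rw [cdf_eq_real, measureReal_def]
  simp only [sampleMeasure, Measure.smul_apply, Measure.coe_finsetSum, Finset.sum_apply,
    Measure.dirac_apply, smul_eq_mul, ENNReal.toReal_mul, ENNReal.toReal_inv,
    ENNReal.toReal_natCast]
  rw [ENNReal.toReal_sum fun s _ => ?_]
  · congr 1
    refine Finset.sum_congr rfl fun s _ => ?_
    by_cases h : x s ∈ Iic t <;> simp [h]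
  · by_cases h : x s ∈ Iic t <;> simp [h]

lemma le_lintegral_cdfDeviation (hI : I.Nonempty) {G : Measure ℝ} {y : ℝ}
    (hy : ENNReal.ofReal y ≤ cdfDist (sampleMeasure I x) G) :
    ENNReal.ofReal (I.card * y) ≤ ∫⁻ t, ENNReal.ofReal |cdfDeviation G I x t| := by
  have hcard : (0 : ℝ) < I.card := by exact_mod_cast hI.card_pos
  have h1 : ∀ t, |cdfDeviation G I x t| = I.card * |cdf (sampleMeasure I x) t - cdf G t| := by
    intro t
    rw [cdf_sampleMeasure hI, cdfDeviation, Finset.sum_sub_distrib, Finset.sum_const,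
      nsmul_eq_mul, ← abs_of_pos hcard, ← abs_mul, mul_sub, abs_of_pos hcard,
      mul_inv_cancel_left₀ hcard.ne']
  have hm : Measurable fun t => ENNReal.ofReal |cdf (sampleMeasure I x) t - cdf G t| :=
    ((measurable_cdf _).sub (measurable_cdf _)).abs.ennreal_ofReal
  simp only [h1, ENNReal.ofReal_mul hcard.le]
  rw [lintegral_const_mul _ hm]
  gcongr
  exact hy

end SampleMeasure

/-! ### Independence of the rewards in the exploration phase -/

section Exploration

variable {S : Type*} [MeasurableSpace S] {P : Measure S} [IsProbabilityMeasure P] {K T : ℕ}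
  {F : Fin K → Measure ℝ} [∀ i, IsProbabilityMeasure (F i)] {A : ℕ → S → Fin K} {X : ℕ → S → ℝ}

instance (t : ℕ) : IsMarkovKernel (armKernel F t) :=
  ⟨fun b => by
    rw [armKernel, Kernel.comap_apply]
    exact inferInstanceAs (IsProbabilityMeasure (F b.2))⟩

/-- While the actions follow a deterministic schedule, the rewards are independent, and each is
distributed as the scheduled arm. -/
lemma IsInteraction.lintegral_prod (hI : IsInteraction P F T A X) {sched : ℕ → Fin K} {n : ℕ}
    (hn : n ≤ T) (hA : ∀ᵐ ω ∂P, ∀ t < n, A t ω = sched t) {g : ℕ → ℝ → ENNReal}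
    (hg : ∀ s, Measurable (g s)) :
    ∫⁻ ω, ∏ s ∈ Finset.range n, g s (X s ω) ∂P
      = ∏ s ∈ Finset.range n, ∫⁻ x, g s x ∂F (sched s) := by
  induction n with
  | zero => simp
  | succ n ih =>
    have hcond := hI n hn
    set Z : S → (Fin n → Fin K × ℝ) × Fin K :=
      fun ω => ((fun s : Fin n => (A s ω, X s ω)), A n ω) with hZ
    have hH : Measurable fun z : (Fin n → Fin K × ℝ) × Fin K =>
        ∏ s : Fin n, g s (z.1 s).2 := by
      refine Finset.measurable_prod _ fun s _ => (hg s).comp ?_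
      fun_prop
    have hκ : Measurable fun z : (Fin n → Fin K × ℝ) × Fin K =>
        ∫⁻ x, g n x ∂(armKernel F n z) := (hg n).lintegral_kernel
    have hprod : Measurable fun p : ((Fin n → Fin K × ℝ) × Fin K) × ℝ =>
        (∏ s : Fin n, g s (p.1.1 s).2) * g n p.2 :=
      (hH.comp measurable_fst).mul ((hg n).comp measurable_snd)
    calc ∫⁻ ω, ∏ s ∈ Finset.range (n + 1), g s (X s ω) ∂P
        = ∫⁻ ω, (∏ s : Fin n, g s ((Z ω).1 s).2) * g n (X n ω) ∂P := by
          refine lintegral_congr fun ω => ?_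
          rw [Finset.prod_range_succ, Finset.prod_range]
      _ = ∫⁻ p, (∏ s : Fin n, g s (p.1.1 s).2) * g n p.2 ∂(P.map fun ω => (Z ω, X n ω)) :=
          (lintegral_map' hprod.aemeasurable hcond.aemeasurable).symm
      _ = ∫⁻ z, (∏ s : Fin n, g s (z.1 s).2) * ∫⁻ x, g n x ∂(armKernel F n z) ∂(P.map Z) := by
          rw [hcond.map_eq, Measure.lintegral_compProd hprod]
          refine lintegral_congr fun z => ?_
          dsimp only
          rw [lintegral_const_mul _ (hg n)]
      _ = ∫⁻ ω, (∏ s : Fin n, g s ((Z ω).1 s).2) * ∫⁻ x, g n x ∂(armKernel F n (Z ω)) ∂P :=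
          lintegral_map' (hH.mul hκ).aemeasurable hcond.aemeasurable_fst
      _ = ∫⁻ ω, (∏ s ∈ Finset.range n, g s (X s ω)) * ∫⁻ x, g n x ∂F (sched n) ∂P := by
          refine lintegral_congr_ae ?_
          filter_upwards [hA] with ω hω
          rw [Finset.prod_range, ← hω n (Nat.lt_succ_self n)]
          rfl
      _ = ∏ s ∈ Finset.range (n + 1), ∫⁻ x, g s x ∂F (sched s) := by
          rw [lintegral_mul_const'' _ ?_, ih (by omega) ?_, Finset.prod_range_succ]
          · filter_upwards [hA] with ω hω t ht using hω t (by omega)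
          · refine Finset.aemeasurable_fun_prod _ fun s hs => ?_
            exact (hg s).comp_aemeasurable
              (hI s (by have := Finset.mem_range.1 hs; omega)).aemeasurable_snd

/-- The rounds before `n` in which the schedule prescribes arm `i`. -/
def armRounds (sched : ℕ → Fin K) (n : ℕ) (i : Fin K) : Finset ℕ :=
  (Finset.range n).filter fun s => sched s = i

lemma IsInteraction.lintegral_prod_armRounds (hI : IsInteraction P F T A X) {sched : ℕ → Fin K}
    {n : ℕ} (hn : n ≤ T) (hA : ∀ᵐ ω ∂P, ∀ t < n, A t ω = sched t) (i : Fin K) {g : ℝ → ENNReal}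
    (hg : Measurable g) :
    ∫⁻ ω, ∏ s ∈ armRounds sched n i, g (X s ω) ∂P
      = (∫⁻ x, g x ∂F i) ^ (armRounds sched n i).card := by
  have h := hI.lintegral_prod hn hA (g := fun s => if sched s = i then g else 1)
    (fun s => by split_ifs <;> fun_prop)
  simp only [armRounds, Finset.prod_filter]
  convert h using 1
  · refine lintegral_congr fun ω => Finset.prod_congr rfl fun s _ => ?_
    split_ifs <;> rfl
  · rw [← Finset.prod_const, Finset.prod_filter]
    refine Finset.prod_congr rfl fun s _ => ?_
    split_ifs with hs
    · rw [hs]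
    · simp

lemma IsInteraction.ae_reward_mem (hI : IsInteraction P F T A X) {Ω : Set ℝ}
    (hΩ : ∀ i, F i Ωᶜ = 0) : ∀ᵐ ω ∂P, ∀ t < T, X t ω ∈ Ω := by
  rw [ae_all_iff]
  intro t
  by_cases ht : t < T
  swap
  · exact ae_of_all _ fun ω h => absurd h ht
  -- a measurable null set, for all arms, that contains the complement of `Ω`
  set N : Set ℝ := ⋂ i : Fin K, toMeasurable (F i) Ωᶜ with hN
  have hNm : MeasurableSet N := MeasurableSet.iInter fun i => measurableSet_toMeasurable _ _
  have hN0 : ∀ i, F i N = 0 := fun i =>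
    measure_mono_null (iInter_subset _ i) ((measure_toMeasurable _).trans (hΩ i))
  have hcond := hI t ht
  have hXN : P {ω | X t ω ∈ N} = 0 := by
    have h1 : P {ω | X t ω ∈ N} = (P.map fun ω => (((fun s : Fin t => (A s ω, X s ω)), A t ω),
        X t ω)) (Prod.snd ⁻¹' N) := by
      rw [Measure.map_apply_of_aemeasurable hcond.aemeasurable (measurable_snd hNm)]
      rfl
    rw [h1, hcond.map_eq, Measure.compProd_apply (measurable_snd hNm)]
    refine (lintegral_congr fun z => ?_).trans lintegral_zero
    exact hN0 z.2
  filter_upwards [measure_eq_zero_iff_ae_notMem.1 hXN] with ω hω _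
  by_contra hX
  exact hω (mem_iInter.2 fun i => subset_toMeasurable _ _ hX)

/-- The exploration phase estimates an arm in the Wasserstein distance, with Gaussian confidence. -/
lemma IsInteraction.measure_le_cdfDist_sampleMeasure_le (hI : IsInteraction P F T A X)
    {sched : ℕ → Fin K} {n : ℕ} (hn : n ≤ T) (hA : ∀ᵐ ω ∂P, ∀ t < n, A t ω = sched t)
    (i : Fin K) (hF : IsOneSubGaussian (F i)) (hne : (armRounds sched n i).Nonempty)
    {y : ℝ} (hy0 : 0 ≤ y) (hy : y ≤ 12) :
    P {ω | ENNReal.ofReal y ≤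
        cdfDist (sampleMeasure (armRounds sched n i) fun s => X s ω) (F i)}
      ≤ ENNReal.ofReal (2 * Real.exp (-((armRounds sched n i).card * y ^ 2 / 640))) := by
  classical
  set I := armRounds sched n i with hIdef
  -- measurable versions of the rewards
  have hXm : ∀ s, s < n → AEMeasurable (X s) P := fun s hs => (hI s (by omega)).aemeasurable_snd
  set X' : ℕ → S → ℝ := fun s => if hs : s < n then (hXm s hs).mk else 0 with hX'
  have hX'm : ∀ s, Measurable (X' s) := by
    intro s
    simp only [hX']
    split_ifs with hs
    · exact (hXm s hs).measurable_mk
    · exact measurable_zero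
  have hae : ∀ᵐ ω ∂P, ∀ s ∈ I, X s ω = X' s ω := by
    have : ∀ᵐ ω ∂P, ∀ s, s < n → X s ω = X' s ω := by
      rw [ae_all_iff]
      intro s
      by_cases hs : s < n
      · filter_upwards [(hXm s hs).ae_eq_mk] with ω hω _
        simp only [hX', hs, dif_pos]
        exact hω
      · exact ae_of_all _ fun ω h => absurd h hs
    filter_upwards [this] with ω hω s hs
    exact hω s (Finset.mem_range.1 (Finset.mem_filter.1 hs).1)
  refine le_trans (measure_mono_ae ?_)
    (hF.measure_le_lintegral_cdfDeviation_le (P := P) (I := I) hX'm (fun g hg => ?_) hy0 hy)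
  · filter_upwards [hae] with ω hω hbad
    refine (le_lintegral_cdfDeviation hne hbad).trans_eq ?_
    refine lintegral_congr fun t => ?_
    rw [cdfDeviation, cdfDeviation, Finset.sum_congr rfl fun s hs => by rw [hω s hs]]
  · rw [← hI.lintegral_prod_armRounds hn hA i hg]
    refine lintegral_congr_ae ?_
    filter_upwards [hae] with ω hω
    exact Finset.prod_congr rfl fun s hs => by rw [hω s hs]

end Exploration


/-! ### The committing phase -/

section Commit

variable {S : Type*} {K : ℕ} {A : ℕ → S → Fin K} {ω : S}

lemma pulls_succ (t : ℕ) (i : Fin K) :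
    pulls A (t + 1) ω i = pulls A t ω i + if A t ω = i then 1 else 0 := by
  rw [pulls, pulls, Finset.range_add_one, Finset.filter_insert]
  split_ifs with h
  · rw [Finset.card_insert_of_notMem (by simp)]
  · rfl

lemma sum_pulls (t : ℕ) : ∑ i, pulls A t ω i = t := by
  simp only [pulls]
  rw [← Finset.card_eq_sum_card_fiberwise fun s _ => Finset.mem_coe.2 (Finset.mem_univ (A s ω)),
    Finset.card_range]

lemma pulls_div_mem_stdSimplex {T : ℕ} (hT : 0 < T) :
    (fun i => (pulls A T ω i : ℝ) / T) ∈ stdSimplex ℝ (Fin K) := by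
  refine ⟨fun i => by positivity, ?_⟩
  rw [← Finset.sum_div, ← Nat.cast_sum, sum_pulls, div_self (by positivity)]

/-- An arm other than the last one is not pulled in the committing phase once it has reached its
target. The last arm is only pulled when all other arms have reached theirs. -/
lemma pulls_commit {T n m : ℕ} {a : Fin K → ℝ} (h0 : ∀ i, pulls A n ω i = m)
    (hc : ∀ t < T, n ≤ t → CommitsTo T a (pulls A t ω) (A t ω)) {t : ℕ} (hnt : n ≤ t)
    (htT : t ≤ T) (i : Fin K) :
    ((i : ℕ) + 1 ≠ K → pulls A t ω i ≤ max m ⌊(T : ℝ) * a i⌋₊) ∧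
    ((i : ℕ) + 1 = K → pulls A t ω i ≤ m ∨ ∀ j < i, ⌊(T : ℝ) * a j⌋₊ ≤ pulls A t ω j) := by
  induction t, hnt using Nat.le_induction with
  | base => exact ⟨fun _ => by rw [h0]; exact le_max_left _ _, fun _ => Or.inl (h0 i).le⟩
  | succ t hnt ih =>
    obtain ⟨ih1, ih2⟩ := ih (by omega)
    obtain ⟨hc1, hc2⟩ := hc t (by omega) hnt
    have hmono : ∀ j, pulls A t ω j ≤ pulls A (t + 1) ω j := fun j => by
      rw [pulls_succ]; exact Nat.le_add_right _ _
    by_cases hi : A t ω = i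
    · subst hi
      refine ⟨fun h => ?_, fun h => Or.inr fun j hj => (hc1 j hj).trans (hmono j)⟩
      rw [pulls_succ, if_pos rfl]
      exact le_max_of_le_right (hc2.resolve_left h)
    · have heq : pulls A (t + 1) ω i = pulls A t ω i := by
        rw [pulls_succ, if_neg hi, add_zero]
      rw [heq]
      exact ⟨ih1, fun h => (ih2 h).imp_right fun h' j hj => (h' j hj).trans (hmono j)⟩

/-- The final proportions of pulls differ from the target by at most twice the length of the
exploration phase and the number of arms. -/
lemma sum_abs_pulls_sub_le {T m : ℕ} (hT : K * m ≤ T) {a : Fin K → ℝ}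
    (ha : a ∈ stdSimplex ℝ (Fin K)) (h0 : ∀ i, pulls A (K * m) ω i = m)
    (hc : ∀ t < T, K * m ≤ t → CommitsTo T a (pulls A t ω) (A t ω)) :
    ∑ i, |(T : ℝ) * a i - pulls A T ω i| ≤ 2 * (K * m + K) := by
  have hTa : ∀ i, 0 ≤ (T : ℝ) * a i := fun i => mul_nonneg T.cast_nonneg (ha.1 i)
  have hsum : ∑ i, (pulls A T ω i : ℝ) = T := by exact_mod_cast sum_pulls (A := A) (ω := ω) T
  have hsum' : ∑ i, (T : ℝ) * a i = T := by rw [← Finset.mul_sum, ha.2, mul_one]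
  -- the overshoot of each arm: the floors cost at most `1` per arm, all charged to the last arm
  have hover : ∀ i : Fin K, (pulls A T ω i : ℝ) - T * a i
      ≤ m + if (i : ℕ) + 1 = K then (K : ℝ) else 0 := by
    intro i
    obtain ⟨h1, h2⟩ := pulls_commit h0 hc hT le_rfl i
    split_ifs with hi
    · rcases h2 hi with h | h
      · have : (pulls A T ω i : ℝ) ≤ m := by exact_mod_cast h
        linarith [hTa i, (Nat.cast_nonneg K : (0 : ℝ) ≤ K)]
      · have hj : ∀ j ∈ Finset.univ.erase i, (T : ℝ) * a j - 1 ≤ pulls A T ω j := by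
          intro j hj
          have hji : j < i := by
            have := Finset.ne_of_mem_erase hj
            have h3 := j.2
            rw [Fin.lt_def]
            have h4 : (j : ℕ) ≠ i := fun h => this (Fin.ext h)
            omega
          have h5 : ((⌊(T : ℝ) * a j⌋₊ : ℕ) : ℝ) ≤ pulls A T ω j := by exact_mod_cast h j hji
          linarith [Nat.lt_floor_add_one ((T : ℝ) * a j)]
        have h6 := Finset.sum_le_sum hj
        rw [Finset.sum_sub_distrib] at h6
        have h7 := Finset.add_sum_erase Finset.univ (fun j => (T : ℝ) * a j) (Finset.mem_univ i)
        have h8 := Finset.add_sum_erase Finset.univ (fun j => (pulls A T ω j : ℝ))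
          (Finset.mem_univ i)
        have h9 : ∑ j ∈ Finset.univ.erase i, (1 : ℝ) ≤ K := by
          rw [Finset.sum_const, nsmul_eq_mul, mul_one]
          exact_mod_cast (Finset.card_le_univ _).trans_eq (Fintype.card_fin K)
        linarith [(Nat.cast_nonneg m : (0 : ℝ) ≤ m)]
    · rw [add_zero]
      rcases le_max_iff.1 (h1 hi) with h | h
      · have : (pulls A T ω i : ℝ) ≤ m := by exact_mod_cast h
        linarith [hTa i]
      · have : (pulls A T ω i : ℝ) ≤ T * a i :=
          le_trans (by exact_mod_cast h) (Nat.floor_le (hTa i))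
        linarith [(Nat.cast_nonneg m : (0 : ℝ) ≤ m)]
  -- both vectors have sum `T`, so the absolute deviations are twice the positive parts
  have habs : ∀ i, |(T : ℝ) * a i - pulls A T ω i| ≤
      2 * (m + if (i : ℕ) + 1 = K then (K : ℝ) else 0) + (T * a i - pulls A T ω i) := by
    intro i
    have h1 := hover i
    have h2 : (0 : ℝ) ≤ m + if (i : ℕ) + 1 = K then (K : ℝ) else 0 := by positivity
    rw [abs_le]
    constructor <;> linarith
  refine (Finset.sum_le_sum fun i _ => habs i).trans ?_
  rw [Finset.sum_add_distrib, Finset.sum_sub_distrib, hsum, hsum', sub_self, add_zero,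
    ← Finset.mul_sum, Finset.sum_add_distrib, Finset.sum_const, Finset.card_univ,
    Fintype.card_fin, nsmul_eq_mul]
  have hlast : ∑ i : Fin K, (if (i : ℕ) + 1 = K then (K : ℝ) else 0) ≤ K := by
    rw [← Finset.sum_filter, Finset.sum_const, nsmul_eq_mul]
    refine mul_le_of_le_one_left K.cast_nonneg ?_
    exact_mod_cast Finset.card_le_one.2 fun i hi j hj => by
      simp only [Finset.mem_filter] at hi hj
      exact Fin.ext (by omega)
  linarith

end Commit


/-! ### Identification of the best discrete mixture -/

/-- A maximizer of a uniform approximation of `f` is the maximizer of `f`, if the error is less than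
half of the gap between the two best values of `f`. -/
lemma eq_of_mem_argmaxOn {α : Type*} {f g : α → ℝ} {D : Set α} {a₁ a₂ a : α} {η : ℝ}
    (ha₁ : a₁ ∈ D) (ha₂ : a₂ ∈ argmaxOn f (D \ {a₁})) (ha : a ∈ argmaxOn g D)
    (hclose : ∀ b ∈ D, |f b - g b| ≤ η) (hgap : 2 * η < f a₁ - f a₂) : a = a₁ := by
  by_contra hne
  have h1 := ha₂.2 a ⟨ha.1, hne⟩
  have h2 := ha.2 a₁ ha₁
  have h3 := abs_le.1 (hclose a ha.1)
  have h4 := abs_le.1 (hclose a₁ ha₁)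
  linarith

section Holder

variable {K : ℕ} {Ω : Set ℝ} {F G : Fin K → Measure ℝ} {h : ℝ → ℝ} {q L : ℝ}

lemma IsHolderPM.abs_V_sub_le (hH : IsHolderPM Ω h q L) (hq : 0 < q) (hL : 0 ≤ L)
    (hF : ∀ i, F i ∈ P1 Ω) (hG : ∀ i, G i ∈ P1 Ω) {x : ℝ} (hx : 0 ≤ x)
    (hFG : ∀ i, cdfDist (G i) (F i) ≤ ENNReal.ofReal x) {a : Fin K → ℝ}
    (ha : a ∈ stdSimplex ℝ (Fin K)) : |V h a F - V h a G| ≤ L * x ^ q := by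
  have key : ∀ F G : Fin K → Measure ℝ, (∀ i, F i ∈ P1 Ω) → (∀ i, G i ∈ P1 Ω) →
      (∀ i, cdfDist (F i) (G i) ≤ ENNReal.ofReal x) → V h a F - V h a G ≤ L * x ^ q := by
    intro F G hF hG hFG
    have := fun i => (hF i).1
    have := fun i => (hG i).1
    refine (hH.2 _ (mix_mem_P1 ha hF) _ (mix_mem_P1 ha hG)).trans ?_
    gcongr
    · exact ENNReal.toReal_nonneg
    · exact W1_mix_le_of_cdfDist_le ha hx hFG
  rw [abs_le]
  constructor
  · linarith [key G F hG hF hFG]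
  · exact key F G hF hG fun i => by rw [cdfDist_comm]; exact hFG i

lemma mem_P1_of_isOneSubGaussian [∀ i, IsProbabilityMeasure (F i)] (hΩ : ∀ i, F i Ωᶜ = 0)
    (hF : ∀ i, IsOneSubGaussian (F i)) (i : Fin K) : F i ∈ P1 Ω :=
  ⟨inferInstance, hΩ i, (hF i).integrable⟩

lemma IsHolderPM.V_sub_V_le [∀ i, IsProbabilityMeasure (F i)] (hH : IsHolderPM Ω h q L)
    (hq : 0 < q) (hL : 0 ≤ L) (hΩ : ∀ i, F i Ωᶜ = 0) (hF : ∀ i, IsOneSubGaussian (F i))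
    {a b : Fin K → ℝ} (ha : a ∈ stdSimplex ℝ (Fin K)) (hb : b ∈ stdSimplex ℝ (Fin K)) {r : ℝ}
    (hr : ∑ i, |a i - b i| ≤ r) : V h a F - V h b F ≤ L * (W F * r) ^ q := by
  have hP := mem_P1_of_isOneSubGaussian hΩ hF
  refine (hH.2 _ (mix_mem_P1 ha hP) _ (mix_mem_P1 hb hP)).trans ?_
  gcongr
  · exact ENNReal.toReal_nonneg
  · refine (W1_mix_le_W_mul_sum ha hb (by norm_num)
      fun i => (hF i).cdfDist_dirac_zero_le).trans ?_
    exact mul_le_mul_of_nonneg_left hr (W_nonneg F)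

/-- Sub-Gaussian arms are at bounded distance of each other, which bounds all gaps. -/
lemma IsHolderPM.V_sub_V_le_twelve [∀ i, IsProbabilityMeasure (F i)] (hH : IsHolderPM Ω h q L)
    (hq : 0 < q) (hL : 0 ≤ L) (hΩ : ∀ i, F i Ωᶜ = 0) (hF : ∀ i, IsOneSubGaussian (F i))
    {a b : Fin K → ℝ} (ha : a ∈ stdSimplex ℝ (Fin K)) (hb : b ∈ stdSimplex ℝ (Fin K)) :
    V h a F - V h b F ≤ L * 12 ^ q := by
  have hP := mem_P1_of_isOneSubGaussian hΩ hF
  refine (hH.2 _ (mix_mem_P1 ha hP) _ (mix_mem_P1 hb hP)).trans ?_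
  gcongr
  · exact ENNReal.toReal_nonneg
  · linarith [W1_mix_le_mul_sum ha hb (by norm_num) fun i => (hF i).cdfDist_dirac_zero_le,
      sum_abs_sub_le_two ha hb]

end Holder

/-! ### The exploration length -/

/-- The accuracy `x` of the exploration phase: a Wasserstein error of `x` for each arm changes
the preference metric of a mixture by at most `L x ^ q = δ / (2 K)`. -/
noncomputable def accuracy (K : ℕ) (L q δ : ℝ) : ℝ := (δ / (2 * K * L)) ^ (1 / q)

section ExplorationLength

variable {K : ℕ} {L q δ ε : ℝ}

lemma accuracy_pos (hK : 0 < K) (hL : 0 < L) (hδ : 0 < δ) : 0 < accuracy K L q δ := by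
  unfold accuracy
  positivity

lemma mul_accuracy_rpow (hK : 0 < K) (hL : 0 < L) (hq : 0 < q) (hδ : 0 < δ) :
    L * accuracy K L q δ ^ q = δ / (2 * K) := by
  rw [accuracy, ← Real.rpow_mul (by positivity), one_div_mul_cancel hq.ne', Real.rpow_one]
  field_simp

lemma accuracy_le_twelve (hK : 0 < K) (hL : 0 < L) (hq : 0 < q) (hδ : 0 < δ)
    (hδ' : δ ≤ L * 12 ^ q) : accuracy K L q δ ≤ 12 := by
  rw [← Real.rpow_le_rpow_iff (accuracy_pos hK hL hδ).le (by norm_num) hq,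
    ← mul_le_mul_iff_of_pos_left hL, mul_accuracy_rpow hK hL hq hδ]
  refine le_trans (div_le_self hδ.le ?_) hδ'
  have : (1 : ℝ) ≤ K := by exact_mod_cast hK
  linarith

lemma explorationLength_nonneg (hL : 0 ≤ L) (hδ : 0 ≤ δ) (T : ℕ) :
    0 ≤ explorationLength K L q δ ε T := by
  unfold explorationLength
  positivity

/-- The union bound over the arms and a power of the horizon fit into the logarithm. -/
lemma log_le_log_exploration (hK : 0 < K) (hε : 0 < ε) {T : ℕ} (hT : 0 < T) :
    Real.log (2 * K * T) ≤ Real.log (2 * K * (T : ℝ) ^ 2 * ((ε ^ (K - 1))⁻¹ + 1)) := by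
  have hK' : (0 : ℝ) < K := by exact_mod_cast hK
  have hT' : (1 : ℝ) ≤ T := by exact_mod_cast hT
  have hε' : 0 ≤ (ε ^ (K - 1))⁻¹ := by positivity
  refine Real.log_le_log (by positivity) ?_
  calc 2 * (K : ℝ) * T ≤ 2 * K * (T : ℝ) ^ 2 := by
        gcongr
        nlinarith
    _ ≤ 2 * K * (T : ℝ) ^ 2 * ((ε ^ (K - 1))⁻¹ + 1) :=
        le_mul_of_one_le_right (by positivity) (by linarith)

lemma le_explorationLength_mul_sq (hK : 0 < K) (hL : 0 < L) (hδ : 0 < δ) (hε : 0 < ε)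
    {T : ℕ} (hT : 0 < T) :
    K * (262144 + 640 * Real.log (2 * K * T))
      ≤ explorationLength K L q δ ε T * accuracy K L q δ ^ 2 := by
  have hK' : (1 : ℝ) ≤ K := by exact_mod_cast hK
  have hT' : (1 : ℝ) ≤ T := by exact_mod_cast hT
  have hlog := log_le_log_exploration hK hε hT
  have hlog0 : 0 ≤ Real.log (2 * K * T) := Real.log_nonneg (by nlinarith)
  unfold explorationLength
  set l := Real.log (2 * K * (T : ℝ) ^ 2 * ((ε ^ (K - 1))⁻¹ + 1)) with hl
  have hl0 : 0 ≤ l := hlog0.trans hlog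
  have hx : (2 * K * L / δ) ^ (2 / q) * accuracy K L q δ ^ 2 = 1 := by
    rw [accuracy, ← Real.rpow_natCast (_ ^ (1 / q)), ← Real.rpow_mul (by positivity),
      show 1 / q * ((2 : ℕ) : ℝ) = 2 / q by push_cast; ring,
      ← Real.mul_rpow (by positivity) (by positivity)]
    rw [show 2 * K * L / δ * (δ / (2 * K * L)) = 1 by field_simp, Real.one_rpow]
  set e := Real.exp 1 with he
  have he0 : 0 < e := Real.exp_pos 1
  have he1 : (5 / 2 : ℝ) ≤ e := by linarith [Real.exp_one_gt_d9]
  have hsq : 1024 + 5 / 2 * l ≤ e * (32 / √e + √l) ^ 2 := by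
    have h1 : e * (32 / √e + √l) ^ 2 = 1024 + 64 * √e * √l + e * l := by
      have h2 : √e ^ 2 = e := Real.sq_sqrt he0.le
      have h3 : √l ^ 2 = l := Real.sq_sqrt hl0
      have h4 : √e ≠ 0 := (Real.sqrt_pos.2 he0).ne'
      calc e * (32 / √e + √l) ^ 2 = √e ^ 2 * (32 / √e + √l) ^ 2 := by rw [h2]
        _ = 1024 + 64 * √e * √l + √e ^ 2 * √l ^ 2 := by
          field_simp
          ring
        _ = _ := by rw [h2, h3]
    rw [h1]
    have : 0 ≤ 64 * √e * √l := by positivity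
    nlinarith
  calc (K : ℝ) * (262144 + 640 * Real.log (2 * K * T))
      ≤ K * (256 * (1024 + 5 / 2 * l)) := by
        gcongr
        linarith
    _ ≤ K * (256 * (e * (32 / √e + √l) ^ 2)) := by gcongr
    _ = 256 * K * e * ((2 * K * L / δ) ^ (2 / q) * accuracy K L q δ ^ 2)
          * (32 / √e + √l) ^ 2 := by rw [hx]; ring
    _ = _ := by ring

lemma four_mul_le_explorationLength (hK : 0 < K) (hL : 0 < L) (hδ : 0 < δ) (hε : 0 < ε)
    (hx : accuracy K L q δ ≤ 12) {T : ℕ} (hT : 0 < T) :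
    4 * (K : ℝ) ≤ explorationLength K L q δ ε T := by
  have hK' : (1 : ℝ) ≤ K := by exact_mod_cast hK
  have hT' : (1 : ℝ) ≤ T := by exact_mod_cast hT
  have hlog0 : 0 ≤ Real.log (2 * K * T) := Real.log_nonneg (by nlinarith)
  have h1 := le_explorationLength_mul_sq (q := q) hK hL hδ hε hT
  have h2 : accuracy K L q δ ^ 2 ≤ 144 := by
    nlinarith [(accuracy_pos (q := q) hK hL hδ).le]
  have h3 := mul_le_mul_of_nonneg_left h2
    (explorationLength_nonneg (K := K) (q := q) (ε := ε) hL.le hδ.le T)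
  have h4 : 0 ≤ (K : ℝ) * (640 * Real.log (2 * K * T)) := by positivity
  nlinarith

/-- With the prescribed number of pulls per arm, the confidence per arm is `1 / (K T)`. -/
lemma two_mul_exp_pullsPerArm_le (hK : 0 < K) (hL : 0 < L) (hδ : 0 < δ) (hε : 0 < ε)
    {T : ℕ} (hT : 0 < T) :
    2 * Real.exp (-(pullsPerArm K L q δ ε T * accuracy K L q δ ^ 2 / 640))
      ≤ 1 / (K * T) := by
  have hK' : (0 : ℝ) < K := by exact_mod_cast hK
  have hT' : (0 : ℝ) < T := by exact_mod_cast hT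
  have h1 := le_explorationLength_mul_sq (q := q) hK hL hδ hε hT
  have h2 : explorationLength K L q δ ε T ≤ K * pullsPerArm K L q δ ε T := by
    rw [← div_le_iff₀' hK']
    exact Nat.le_ceil _
  have h3 := mul_le_mul_of_nonneg_right h2 (sq_nonneg (accuracy K L q δ))
  have h4 : 262144 + 640 * Real.log (2 * K * T)
      ≤ pullsPerArm K L q δ ε T * accuracy K L q δ ^ 2 := by
    have := h1.trans h3
    rw [mul_assoc (K : ℝ) (pullsPerArm K L q δ ε T : ℝ)] at this
    exact le_of_mul_le_mul_left this hK'
  calc 2 * Real.exp (-(pullsPerArm K L q δ ε T * accuracy K L q δ ^ 2 / 640))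
      ≤ 2 * Real.exp (-Real.log (2 * K * T)) := by
        gcongr
        linarith
    _ = 1 / (K * T) := by
        rw [Real.exp_neg, Real.exp_log (by positivity)]
        field_simp

/-- The exploration length is of the order of the logarithm of the horizon. -/
lemma isBigO_explorationFactor (hK : 0 < K) (hL : 0 ≤ L) (hδ : 0 < δ) (hε : 0 < ε) :
    (fun T : ℕ => explorationFactor K L q δ ε T) =O[atTop] fun _ => (1 : ℝ) := by
  have hK' : (0 : ℝ) < K := by exact_mod_cast hK
  set C := 256 * K * Real.exp 1 * (2 * K * L / δ) ^ (2 / q) with hC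
  have hC0 : 0 ≤ C := by positivity
  set b := 2 * K * ((ε ^ (K - 1))⁻¹ + 1) with hb
  have hb0 : 0 < b := by positivity
  set c := 32 / √(Real.exp 1) with hc
  refine Asymptotics.IsBigO.of_bound (C * (2 * c ^ 2 + 2 * (|Real.log b| + 2))) ?_
  have hlog : ∀ᶠ T : ℕ in atTop, 1 ≤ Real.log T :=
    (Real.tendsto_log_atTop.comp tendsto_natCast_atTop_atTop).eventually_ge_atTop 1
  filter_upwards [hlog, eventually_gt_atTop 0] with T hT1 hT0
  have hT' : (0 : ℝ) < T := by exact_mod_cast hT0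
  have h0 : 0 ≤ explorationFactor K L q δ ε T :=
    div_nonneg (explorationLength_nonneg hL hδ.le T) (by linarith)
  rw [Real.norm_of_nonneg h0, norm_one, mul_one, explorationFactor, div_le_iff₀ (by linarith),
    explorationLength, ← hC, ← hc, mul_assoc C]
  gcongr
  rw [show 2 * K * (T : ℝ) ^ 2 * ((ε ^ (K - 1))⁻¹ + 1) = b * (T : ℝ) ^ 2 by rw [hb]; ring,
    Real.log_mul hb0.ne' (by positivity), Real.log_pow]
  push_cast
  set l := Real.log b + 2 * Real.log T with hl
  have h1 : (c + √l) ^ 2 ≤ 2 * c ^ 2 + 2 * √l ^ 2 := by nlinarith [sq_nonneg (c - √l)]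
  have h2 : √l ^ 2 ≤ (|Real.log b| + 2) * Real.log T := by
    have h3 : l ≤ (|Real.log b| + 2) * Real.log T := by
      nlinarith [le_abs_self (Real.log b), abs_nonneg (Real.log b)]
    rcases le_total 0 l with h | h
    · rwa [Real.sq_sqrt h]
    · rw [Real.sqrt_eq_zero_of_nonpos h, zero_pow two_ne_zero]
      have : 0 ≤ |Real.log b| := abs_nonneg _
      positivity
  nlinarith [sq_nonneg c]

end ExplorationLength

/-! ### The regret -/

section Regret

variable {S : Type*} [MeasurableSpace S] {P : Measure S} {K T : ℕ}
  {F : Fin K → Measure ℝ} {A : ℕ → S → Fin K} {X : ℕ → S → ℝ}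

lemma IsInteraction.aemeasurable_comp_pulls (hI : IsInteraction P F T A X)
    (f : (Fin K → ℕ) → ℝ) : AEMeasurable (fun ω => f (pulls A T ω)) P := by
  have hA : AEMeasurable (fun ω (s : Fin T) => A s ω) P :=
    aemeasurable_pi_lambda _ fun s => (hI s s.2).aemeasurable_fst.snd
  have hf : Measurable fun v : Fin T → Fin K => f fun i => ∑ s, if v s = i then 1 else 0 :=
    Measurable.of_discrete
  convert hf.comp_aemeasurable hA using 2 with ω
  simp only [Function.comp_apply]
  congr 1
  funext i
  rw [pulls, Finset.card_filter, Finset.sum_range]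

/-- A lower bound on an integral, when the integrand can be smaller on an event of small
probability. -/
lemma sub_le_integral_of_forall_notMem [IsProbabilityMeasure P] {f : S → ℝ} (hf : Integrable f P) {B : Set S} {p : ℝ}
    (hp : 0 ≤ p) (hB : P B ≤ ENNReal.ofReal p) {c C₁ C₂ : ℝ} (hC₁ : 0 ≤ C₁) (hC₂ : 0 ≤ C₂)
    (hall : ∀ᵐ ω ∂P, c - C₂ ≤ f ω) (hgood : ∀ᵐ ω ∂P, ω ∉ B → c - C₁ ≤ f ω) :
    c - (C₁ + C₂ * p) ≤ ∫ ω, f ω ∂P := by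
  have hm := measurableSet_toMeasurable P B
  have hp' : P.real (toMeasurable P B) ≤ p := by
    rw [measureReal_def, measure_toMeasurable]
    exact ENNReal.toReal_le_of_le_ofReal hp hB
  have hint : Integrable ((toMeasurable P B).indicator fun _ => C₂) P :=
    (integrable_const _).indicator hm
  calc c - (C₁ + C₂ * p)
      ≤ c - C₁ - P.real (toMeasurable P B) * C₂ := by nlinarith
    _ = ∫ ω, ((c - C₁) - (toMeasurable P B).indicator (fun _ => C₂) ω) ∂P := by
        rw [integral_sub (integrable_const _) hint, integral_const, probReal_univ, one_smul,
          integral_indicator_const _ hm, smul_eq_mul]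
    _ ≤ ∫ ω, f ω ∂P := by
        refine integral_mono_ae ((integrable_const _).sub hint) hf ?_
        filter_upwards [hall, hgood] with ω h1 h2
        by_cases hω : ω ∈ toMeasurable P B
        · simp only [indicator_of_mem hω]
          linarith
        · simp only [indicator_of_notMem hω]
          linarith [h2 fun h => hω (subset_toMeasurable P B h)]

end Regret


section ETC

variable {S : Type*} {K T : ℕ} {Ω : Set ℝ} {F : Fin K → Measure ℝ}
  [∀ i, IsProbabilityMeasure (F i)] {h : ℝ → ℝ} {q L : ℝ} {A : ℕ → S → Fin K} {X : ℕ → S → ℝ}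

/-- On the event that the exploration phase estimates all arms well, the algorithm commits to the
best discrete mixture and tracks it. -/
lemma sum_abs_sub_pulls_div_le {ε δ x : ℝ} {m : ℕ} (hH : IsHolderPM Ω h q L) (hq : 0 < q)
    (hL : 0 ≤ L) (hΩ : ∀ i, F i Ωᶜ = 0) (hF : ∀ i, IsOneSubGaussian (F i))
    {a₁ a₂ : Fin K → ℝ} (ha₁ : a₁ ∈ discSimplex K ε)
    (ha₂ : a₂ ∈ argmaxOn (fun a => V h a F) (discSimplex K ε \ {a₁}))
    (hδ : δ = V h a₁ F - V h a₂ F) (hδ0 : 0 < δ) (hx0 : 0 ≤ x) (hx : L * x ^ q ≤ δ / 4)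
    (hT : 0 < T) (hm : 0 < m) (hmT : K * m ≤ T) {sched : ℕ → Fin K}
    (hsched : ∀ i, (armRounds sched (K * m) i).card = m) {ω : S} {a : Fin K → ℝ}
    (hA : ∀ t < K * m, A t ω = sched t) (hXΩ : ∀ t < T, X t ω ∈ Ω)
    (ha : a ∈ argmaxOn (fun a => V h a (empirical A X (K * m) ω)) (discSimplex K ε))
    (hc : ∀ t < T, K * m ≤ t → CommitsTo T a (pulls A t ω) (A t ω))
    (hgood : ∀ i, cdfDist (sampleMeasure (armRounds sched (K * m) i) fun s => X s ω) (F i)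
      ≤ ENNReal.ofReal x) :
    ∑ i, |a₁ i - (pulls A T ω i : ℝ) / T| ≤ 2 * (K * m + K) / T := by
  have hrounds : ∀ i, (Finset.range (K * m)).filter (fun s => A s ω = i)
      = armRounds sched (K * m) i := fun i =>
    Finset.filter_congr fun s hs => by rw [hA s (Finset.mem_range.1 hs)]
  have hpulls : ∀ i, pulls A (K * m) ω i = m := fun i => by
    rw [pulls, hrounds, hsched]
  have hemp : ∀ i, empirical A X (K * m) ω i
      = sampleMeasure (armRounds sched (K * m) i) fun s => X s ω := fun i => by
    rw [empirical, pulls, hrounds, sampleMeasure]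
  have hempP : ∀ i, empirical A X (K * m) ω i ∈ P1 Ω := fun i => by
    rw [hemp]
    refine sampleMeasure_mem_P1 (Finset.card_pos.1 (by rw [hsched]; exact hm)) fun s hs => ?_
    exact hXΩ s ((Finset.mem_range.1 (Finset.mem_filter.1 hs).1).trans_le hmT)
  have haeq : a = a₁ := by
    refine eq_of_mem_argmaxOn ha₁ ha₂ ha (η := δ / 4) (fun b hb => ?_) (by linarith)
    refine le_trans ?_ hx
    exact hH.abs_V_sub_le hq hL (mem_P1_of_isOneSubGaussian hΩ hF) hempP hx0
      (fun i => by rw [hemp]; exact hgood i) hb.1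
  subst haeq
  have hT' : (0 : ℝ) < T := by exact_mod_cast hT
  have htrack := sum_abs_pulls_sub_le hmT ha₁.1 hpulls hc
  rw [le_div_iff₀ hT', Finset.sum_mul]
  refine le_trans (le_of_eq (Finset.sum_congr rfl fun i _ => ?_)) htrack
  rw [← abs_of_pos hT', ← abs_mul, abs_of_pos hT', sub_mul, div_mul_cancel₀ _ hT'.ne', mul_comm]

variable [MeasurableSpace S] {P : Measure S} [IsProbabilityMeasure P]

/-- If the proportions of pulls are within `ℓ¹` distance `r` of `a`, off an event of probability at
most `p`, then the expected loss with respect to `a` is at most the loss for the distance `r`, plus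
`p` times the loss for the distance `2`, which is the diameter of the simplex. -/
lemma IsInteraction.sub_le_integral_V (hI : IsInteraction P F T A X) (hT : 0 < T)
    (hH : IsHolderPM Ω h q L) (hq : 0 < q) (hL : 0 ≤ L) (hΩ : ∀ i, F i Ωᶜ = 0)
    (hF : ∀ i, IsOneSubGaussian (F i)) {a : Fin K → ℝ} (ha : a ∈ stdSimplex ℝ (Fin K)) {r p : ℝ}
    (hr : 0 ≤ r) (hp : 0 ≤ p) {B : Set S} (hB : P B ≤ ENNReal.ofReal p)
    (hgood : ∀ᵐ ω ∂P, ω ∉ B → ∑ i, |a i - (pulls A T ω i : ℝ) / T| ≤ r) :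
    V h a F - (L * (W F * r) ^ q + L * (W F * 2) ^ q * p)
      ≤ ∫ ω, V h (fun i => (pulls A T ω i : ℝ) / T) F ∂P := by
  have hW := W_nonneg F
  have hτ : ∀ ω, (fun i => (pulls A T ω i : ℝ) / T) ∈ stdSimplex ℝ (Fin K) :=
    fun ω => pulls_div_mem_stdSimplex hT
  have hint : Integrable (fun ω => V h (fun i => (pulls A T ω i : ℝ) / T) F) P := by
    refine Integrable.of_mem_Icc (V h a F - L * (W F * 2) ^ q) (V h a F + L * (W F * 2) ^ q)
      (hI.aemeasurable_comp_pulls fun n => V h (fun i => (n i : ℝ) / T) F)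
      (ae_of_all _ fun ω => ⟨?_, ?_⟩)
    · linarith [hH.V_sub_V_le hq hL hΩ hF ha (hτ ω) (sum_abs_sub_le_two ha (hτ ω))]
    · linarith [hH.V_sub_V_le hq hL hΩ hF (hτ ω) ha (sum_abs_sub_le_two (hτ ω) ha)]
  refine sub_le_integral_of_forall_notMem hint hp hB (by positivity) (by positivity)
    (ae_of_all _ fun ω => ?_) ?_
  · linarith [hH.V_sub_V_le hq hL hΩ hF ha (hτ ω) (sum_abs_sub_le_two ha (hτ ω))]
  · filter_upwards [hgood] with ω hω hωB
    linarith [hH.V_sub_V_le hq hL hΩ hF ha (hτ ω) (hω hωB)]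

/-- The event that the exploration phase misestimates some arm has probability at most `1 / T`. -/
lemma IsInteraction.measure_iUnion_le {δ ε : ℝ} (hI : IsInteraction P F T A X) (hT : 0 < T)
    (hF : ∀ i, IsOneSubGaussian (F i)) (hK : 0 < K) (hL : 0 < L) (hδ : 0 < δ) (hε : 0 < ε)
    (hx : accuracy K L q δ ≤ 12) (hm : 0 < pullsPerArm K L q δ ε T)
    (hmT : K * pullsPerArm K L q δ ε T ≤ T) {sched : ℕ → Fin K}
    (hsched : ∀ i, (armRounds sched (K * pullsPerArm K L q δ ε T) i).card
      = pullsPerArm K L q δ ε T)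
    (hA : ∀ᵐ ω ∂P, ∀ t < K * pullsPerArm K L q δ ε T, A t ω = sched t) :
    P (⋃ i, {ω | ENNReal.ofReal (accuracy K L q δ) ≤ cdfDist
        (sampleMeasure (armRounds sched (K * pullsPerArm K L q δ ε T) i) fun s => X s ω) (F i)})
      ≤ ENNReal.ofReal (1 / T) := by
  have hK' : (0 : ℝ) < K := by exact_mod_cast hK
  refine (measure_iUnion_fintype_le _ _).trans ?_
  calc _ ≤ ∑ _i : Fin K, ENNReal.ofReal (1 / (K * T)) := by
        refine Finset.sum_le_sum fun i _ => ?_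
        refine (hI.measure_le_cdfDist_sampleMeasure_le hmT hA i (hF i)
          (Finset.card_pos.1 (by rw [hsched]; exact hm)) (accuracy_pos hK hL hδ).le hx).trans ?_
        rw [hsched]
        exact ENNReal.ofReal_le_ofReal (two_mul_exp_pullsPerArm_le hK hL hδ hε hT)
    _ = ENNReal.ofReal (1 / T) := by
        rw [Finset.sum_const, Finset.card_univ, Fintype.card_fin, ← ENNReal.ofReal_nsmul,
          nsmul_eq_mul]
        congr 1
        field_simp

/-- The expected loss of PM-ETC-M with respect to the best discrete mixture. -/
lemma FollowsETC.sub_integral_V_le {δ ε : ℝ} (hI : IsInteraction P F T A X)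
    (hfol : FollowsETC P h ε T (pullsPerArm K L q δ ε T) A X)
    (hK : 2 ≤ K) (hΩ : ∀ i, F i Ωᶜ = 0) (hF : ∀ i, IsOneSubGaussian (F i)) (hq : 0 < q)
    (hq_le : q ≤ 1) (hL : 0 < L) (hH : IsHolderPM Ω h q L) (hε : 0 < ε) {a₁ a₂ : Fin K → ℝ}
    (ha₁ : a₁ ∈ discSimplex K ε)
    (ha₂ : a₂ ∈ argmaxOn (fun a => V h a F) (discSimplex K ε \ {a₁}))
    (hδ : δ = V h a₁ F - V h a₂ F) (hδ0 : 0 < δ)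
    (hT : explorationLength K L q δ ε T < T) :
    V h a₁ F - ∫ ω, V h (fun i => (pulls A T ω i : ℝ) / T) F ∂P
      ≤ L * K * (3 * W F * (explorationLength K L q δ ε T / T)) ^ q := by
  have hK0 : 0 < K := by omega
  have hK' : (2 : ℝ) ≤ K := by exact_mod_cast hK
  have hT' : (0 : ℝ) < T := (explorationLength_nonneg hL.le hδ0.le T).trans_lt hT
  have hT0 : 0 < T := by exact_mod_cast hT'
  have hx := accuracy_le_twelve hK0 hL hq hδ0
    (hδ ▸ hH.V_sub_V_le_twelve hq hL.le hΩ hF ha₁.1 ha₂.1.1.1)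
  have hN := four_mul_le_explorationLength (q := q) hK0 hL hδ0 hε hx hT0
  set N := explorationLength K L q δ ε T with hNdef
  have hN0 : 0 < N := by linarith
  have hW := W_nonneg F
  have hterm : 0 ≤ L * (3 * W F * (N / T)) ^ q := by positivity
  have hKterm : 2 * (L * (3 * W F * (N / T)) ^ q) ≤ L * K * (3 * W F * (N / T)) ^ q := by
    nlinarith
  rcases le_or_gt (T : ℝ) (3 / 2 * N) with hshort | hlong
  · -- the horizon is so short that the bound exceeds the diameter of the simplex
    have h1 := hI.sub_le_integral_V hT0 hH hq hL.le hΩ hF ha₁.1 (r := 2) (p := 0)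
      (B := ∅) (by norm_num) le_rfl (by simp)
      (ae_of_all _ fun ω _ => sum_abs_sub_le_two ha₁.1 (pulls_div_mem_stdSimplex hT0))
    have h2 : W F * 2 ≤ 3 * W F * (N / T) := by
      have : 2 ≤ 3 * (N / T) := by
        rw [← mul_div_assoc, le_div_iff₀ hT']
        linarith
      nlinarith
    have h3 : L * (W F * 2) ^ q ≤ L * (3 * W F * (N / T)) ^ q := by gcongr
    linarith
  · obtain ⟨sched, ahat, hsched, hae⟩ := hfol
    set m := pullsPerArm K L q δ ε T with hmdef
    have hKm : (K : ℝ) * m ≤ N + K := by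
      have h1 : (m : ℝ) ≤ N / K + 1 := (Nat.ceil_lt_add_one (by positivity)).le
      calc (K : ℝ) * m ≤ K * (N / K + 1) := by gcongr
        _ = N + K := by field_simp
    have hm : 0 < m := Nat.ceil_pos.2 (by positivity)
    have hmT : K * m ≤ T := by
      have : (K : ℝ) * m ≤ T := by linarith
      exact_mod_cast this
    have hA : ∀ᵐ ω ∂P, ∀ t < K * m, A t ω = sched t := by
      filter_upwards [hae] with ω hω t ht using hω.1 t (by omega) ht
    have hx4 : L * accuracy K L q δ ^ q ≤ δ / 4 := by
      rw [mul_accuracy_rpow hK0 hL hq hδ0]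
      gcongr
      linarith
    have h1 := hI.sub_le_integral_V hT0 hH hq hL.le hΩ hF ha₁.1 (r := 3 * (N / T))
      (p := 1 / T) (by positivity) (by positivity)
      (hI.measure_iUnion_le hT0 hF hK0 hL hδ0 hε hx hm hmT hsched hA) (by
        filter_upwards [hae, hA, hI.ae_reward_mem hΩ] with ω hω hAω hXω hgood
        refine (sum_abs_sub_pulls_div_le hH hq hL.le hΩ hF ha₁ ha₂ hδ hδ0
          (accuracy_pos hK0 hL hδ0).le hx4 hT0 hm hmT hsched hAω hXω hω.2.1 hω.2.2
          fun i => ?_).trans ?_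
        · simp only [mem_iUnion, not_exists, mem_ofPred_eq, not_le] at hgood
          exact (hgood i).le
        · rw [← mul_div_assoc]
          exact div_le_div_of_nonneg_right (by linarith) hT'.le)
    -- the misestimation event has probability `1 / T ≤ (1 / T) ^ q`
    have h2 : L * (W F * 2) ^ q * (1 / T) ≤ L * (3 * W F * (N / T)) ^ q := by
      have h3 : (1 : ℝ) / T ≤ (1 / T) ^ q := by
        refine Real.self_le_rpow_of_le_one (by positivity) ?_ hq_le
        rw [div_le_one hT']
        exact_mod_cast hT0
      have h4 : W F * 2 * (1 / T) ≤ 3 * W F * (N / T) := by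
        rw [show W F * 2 * (1 / T) = W F * 2 / T by ring,
          show 3 * W F * (N / T) = W F * (3 * N) / T by ring]
        gcongr
        linarith
      calc L * (W F * 2) ^ q * (1 / T) ≤ L * (W F * 2) ^ q * (1 / T) ^ q := by gcongr
        _ = L * (W F * 2 * (1 / T)) ^ q := by
          rw [mul_assoc, ← Real.mul_rpow (by positivity) (by positivity)]
        _ ≤ L * (3 * W F * (N / T)) ^ q := by gcongr
    rw [show W F * (3 * (N / T)) = 3 * W F * (N / T) by ring] at h1
    linarith

end ETC

end PMBandit

theorem theorem5 {K : ℕ} (hK : 2 ≤ K)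
    -- the arms: probability measures on `Ω ⊆ ℝ`, 1-sub-Gaussian
    (Ω : Set ℝ) (F : Fin K → Measure ℝ) [∀ i, IsProbabilityMeasure (F i)]
    (hΩ : ∀ i, F i Ωᶜ = 0) (hF : ∀ i, PMBandit.IsOneSubGaussian (F i))
    -- the distortion function, with a Hölder continuous preference metric
    (h : ℝ → ℝ) (hmaps : MapsTo h (Icc 0 1) (Icc 0 1)) (h_zero : h 0 = 0)
    (q L : ℝ) (hq : 0 < q) (hq_le : q ≤ 1) (hL : 0 ≤ L) (hH : PMBandit.IsHolderPM Ω h q L)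
    -- the discretization level, the oracle and the two best discrete mixing coefficients
    (ε : ℝ) (hε : 0 < ε) (αstar a₁ a₂ : Fin K → ℝ)
    (hα : αstar ∈ PMBandit.argmaxOn (fun a => PMBandit.V h a F) (stdSimplex ℝ (Fin K)))
    (ha₁ : a₁ ∈ PMBandit.argmaxOn (fun a => PMBandit.V h a F) (PMBandit.discSimplex K ε))
    (ha₂ : a₂ ∈ PMBandit.argmaxOn (fun a => PMBandit.V h a F) (PMBandit.discSimplex K ε \ {a₁}))
    (δ₀₁ δ₁₂ : ℝ) (hδ₀₁ : δ₀₁ = PMBandit.V h αstar F - PMBandit.V h a₁ F)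
    (hδ₁₂ : δ₁₂ = PMBandit.V h a₁ F - PMBandit.V h a₂ F) (hδ₁₂_pos : 0 < δ₁₂) :
    (fun T : ℕ => PMBandit.explorationFactor K L q δ₁₂ ε T) =O[atTop] (fun _ => (1 : ℝ)) ∧
    ∀ T : ℕ, PMBandit.explorationLength K L q δ₁₂ ε T < T →
      ∀ (S : Type*) [MeasurableSpace S] (P : Measure S) [IsProbabilityMeasure P]
        (A : ℕ → S → Fin K) (X : ℕ → S → ℝ),
        PMBandit.IsInteraction P F T A X →
        PMBandit.FollowsETC P h ε T (PMBandit.pullsPerArm K L q δ₁₂ ε T) A X →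
        PMBandit.regret P F h αstar T A ≤
          (L * K + PMBandit.W F ^ (-q)) *
            (3 * PMBandit.W F * PMBandit.explorationFactor K L q δ₁₂ ε T *
              (Real.log T / T)) ^ q + δ₀₁ := by
  have hK0 : 0 < K := by omega
  refine ⟨PMBandit.isBigO_explorationFactor hK0 hL hδ₁₂_pos hε, ?_⟩
  intro T hT S _ P _ A X hI hfol
  -- a positive gap is impossible for a constant preference metric
  have hgap := hH.V_sub_V_le_twelve hq hL hΩ hF ha₁.1.1 ha₂.1.1.1
  have hL0 : 0 < L := by
    refine hL.lt_of_ne fun h0 => ?_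
    rw [← h0, zero_mul] at hgap
    linarith
  have hT' : (0 : ℝ) < T :=
    (PMBandit.explorationLength_nonneg hL hδ₁₂_pos.le T).trans_lt hT
  have hN := PMBandit.four_mul_le_explorationLength hK0 hL0 hδ₁₂_pos hε
    (PMBandit.accuracy_le_twelve hK0 hL0 hq hδ₁₂_pos (hδ₁₂ ▸ hgap)) (T := T)
    (by exact_mod_cast hT')
  have hlog : Real.log T ≠ 0 := by
    have : (2 : ℝ) ≤ K := by exact_mod_cast hK
    exact (Real.log_pos (by linarith)).ne'
  have hW := PMBandit.W_nonneg F
  have hloss := hfol.sub_integral_V_le hI hK hΩ hF hq hq_le hL0 hH hε ha₁.1 ha₂ hδ₁₂ hδ₁₂_pos hT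
  rw [PMBandit.explorationFactor, show ∀ w N l : ℝ, l ≠ 0 →
    3 * w * (N / l) * (l / T) = 3 * w * (N / T) from fun w N l hl => by field_simp]
  swap
  · exact hlog
  have hextra : 0 ≤ PMBandit.W F ^ (-q) *
      (3 * PMBandit.W F * (PMBandit.explorationLength K L q δ₁₂ ε T / T)) ^ q :=
    mul_nonneg (Real.rpow_nonneg hW _) (Real.rpow_nonneg (mul_nonneg (by positivity)
      (div_nonneg (PMBandit.explorationLength_nonneg hL hδ₁₂_pos.le T) hT'.le)) _)
  rw [PMBandit.regret, add_mul]
  linarith
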